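/- Let $Q,N>0$. Let $X_0\sim\mathcal N(0,Q)$, and consider the Witsenhausen channel $X_1=X_0+U_1$, $Y_1=X_1+Z_1$, where $Z_1\sim\mathcal N(0,N)$ is independent of $(X_0,U_1)$; write $\mathcal P_{X_1,Y_1|X_0,U_1}$ for the corresponding conditional distribution. For $P\ge 0$ let $\mathbb P(P)$ be the set of quadruples $(\mathcal P_{W_1},\mathcal P_{W_2|X_0,W_1},\mathcal P_{U_1|X_0,W_1},\mathcal P_{U_2|W_1,W_2,Y_1})$ of (conditional) probability distributions of real random variables such that, under the joint law $$\mathcal P_{X_0}\,\mathcal P_{W_1}\,\mathcal P_{W_2|X_0,W_1}\,\mathcal P_{U_1|X_0,W_1}\,\mathcal P_{X_1,Y_1|X_0,U_1}\,\mathcal P_{U_2|W_1,W_2,Y_1},$$ the variables $X_0,W_1,W_2,U_1,X_1,Y_1,U_2$ are jointly Gaussian (possibly degenerate, not necessarily centered), $\mathbb E[U_1^2]=P$, and $$I(W_1,W_2;Y_1)-I(W_2;X_0\,|\,W_1)\ \ge\ 0 .$$ The optimal Gaussian estimation cost (causal encoder, non-causal decoder) is $$S_{\mathsf G}(P)=\inf_{\mathbb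 P(P)}\mathbb E\big[(X_1-U_2)^2\big].$$ Let the best linear cost be $$S_\ell(P)=\begin{cases}\dfrac{(\sqrt Q-\sqrt P)^2\,N}{(\sqrt Q-\sqrt P)^2+N}&\text{if }P\in[0,Q],\\[1ex] 0&\text{if } P>Q,\end{cases}$$ and let $P_1=\tfrac12\big(Q-2N-\sqrt{Q^2-4QN}\big)$ and $P_2=\tfrac12\big(Q-2N+\sqrt{Q^2-4QN}\big)$. Then for every $P\ge 0$ the set $\mathbb P(P)$ is non-empty and $$S_{\mathsf G}(P)=\begin{cases}\dfrac{N\,(Q-N-P)}{Q}&\text{if }Q>4N\text{ and }P\in[P_1,P_2],\\[1ex] S_\ell(P)&\text{otherwise.}\end{cases}$$ Moreover, $S_{\mathsf G}$ is the convex envelope of $S_\ell$ on $[0,\infty)$, i.e. the greatest convex function on $[0,\infty)$ that is nowhere larger than $S_\ell$. -/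

import Mathlib

open MeasureTheory ProbabilityTheory
open scoped ENNReal

/-- Mutual information `I(A; B)` (in nats) under `μ`: the Kullback-Leibler divergence between the
joint law of `(A, B)` and the product of the marginal laws. -/
noncomputable def mutualInformation {Ω α β : Type*} [MeasurableSpace Ω] [MeasurableSpace α]
    [MeasurableSpace β] (μ : Measure Ω) (A : Ω → α) (B : Ω → β) : ℝ≥0∞ :=
  InformationTheory.klDiv (μ.map (fun ω => (A ω, B ω))) ((μ.map A).prod (μ.map B))

/-- Conditional mutual information `I(A; B | C)` (in nats) under `μ`: the Kullback-Leibler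
divergence between the law of `(C, (A, B))` and the law `P_C P_{A|C} P_{B|C}` that has the same
conditional marginals and makes `A` and `B` conditionally independent given `C`. -/
noncomputable def condMutualInformation {Ω α β γ : Type*} [MeasurableSpace Ω]
    [MeasurableSpace α] [StandardBorelSpace α] [Nonempty α]
    [MeasurableSpace β] [StandardBorelSpace β] [Nonempty β] [MeasurableSpace γ]
    (μ : Measure Ω) [IsFiniteMeasure μ] (A : Ω → α) (B : Ω → β) (C : Ω → γ) : ℝ≥0∞ :=
  InformationTheory.klDiv (μ.map (fun ω => (C ω, (A ω, B ω))))
    ((μ.map C).compProd ((condDistrib A C μ).prod (condDistrib B C μ)))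

namespace Witsenhausen

/-- The channel `P_{X₁,Y₁|X₀,U₁}`: `X₁ = X₀ + U₁` and `Y₁ = X₁ + Z₁`, where `Z₁ ∼ 𝒩(0, N)` is
independent of the input `(X₀, U₁)`. -/
noncomputable def channel (N : ℝ) : Kernel (ℝ × ℝ) (ℝ × ℝ) :=
  (Kernel.id.prod (Kernel.const (ℝ × ℝ) (gaussianReal 0 N.toNNReal))).map
    (fun p : (ℝ × ℝ) × ℝ => (p.1.1 + p.1.2, p.1.1 + p.1.2 + p.2))

instance (N : ℝ) : IsMarkovKernel (channel N) :=
  Kernel.IsMarkovKernel.map _ (by fun_prop)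

/-- The quadruples `(P_{W₁}, P_{W₂|X₀,W₁}, P_{U₁|X₀,W₁}, P_{U₂|W₁,W₂,Y₁})` of (conditional)
probability distributions over which one optimizes. -/
structure Policy where
  /-- `P_{W₁}` -/
  lawW1 : Measure ℝ
  /-- `P_{W₂|X₀,W₁}` -/
  kerW2 : Kernel (ℝ × ℝ) ℝ
  /-- `P_{U₁|X₀,W₁}` -/
  kerU1 : Kernel (ℝ × ℝ) ℝ
  /-- `P_{U₂|W₁,W₂,Y₁}` -/
  kerU2 : Kernel (ℝ × ℝ × ℝ) ℝ
  probW1 : IsProbabilityMeasure lawW1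
  markovW2 : IsMarkovKernel kerW2
  markovU1 : IsMarkovKernel kerU1
  markovU2 : IsMarkovKernel kerU2

attribute [instance] Policy.probW1 Policy.markovW2 Policy.markovU1 Policy.markovU2

/-- The space of values of `((((X₀, W₁), (W₂, U₁)), (X₁, Y₁)), U₂)`. -/
abbrev Outcome : Type := (((ℝ × ℝ) × (ℝ × ℝ)) × (ℝ × ℝ)) × ℝ

namespace Outcome

def X0 (ω : Outcome) : ℝ := ω.1.1.1.1
def W1 (ω : Outcome) : ℝ := ω.1.1.1.2
def W2 (ω : Outcome) : ℝ := ω.1.1.2.1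
def U1 (ω : Outcome) : ℝ := ω.1.1.2.2
def X1 (ω : Outcome) : ℝ := ω.1.2.1
def Y1 (ω : Outcome) : ℝ := ω.1.2.2
def U2 (ω : Outcome) : ℝ := ω.2

end Outcome

/-- The joint law
`P_{X₀} P_{W₁} P_{W₂|X₀,W₁} P_{U₁|X₀,W₁} P_{X₁,Y₁|X₀,U₁} P_{U₂|W₁,W₂,Y₁}` with
`P_{X₀} = 𝒩(0, Q)`. -/
noncomputable def jointLaw (Q N : ℝ) (π : Policy) : Measure Outcome :=
  ((((gaussianReal 0 Q.toNNReal).prod π.lawW1).compProd (π.kerW2.prod π.kerU1)).compProd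
    ((channel N).comap (fun p : (ℝ × ℝ) × (ℝ × ℝ) => (p.1.1, p.2.2)) (by fun_prop))).compProd
    (π.kerU2.comap
      (fun p : ((ℝ × ℝ) × (ℝ × ℝ)) × (ℝ × ℝ) => (p.1.1.2, p.1.2.1, p.2.2)) (by fun_prop))

instance (Q N : ℝ) (π : Policy) : IsProbabilityMeasure (jointLaw Q N π) := by
  unfold jointLaw; infer_instance

/-- The optimization domain: the policies with power cost `E[U₁²] = P` that satisfy the
information constraint `I(W₁, W₂; Y₁) - I(W₂; X₀ | W₁) ≥ 0` and for which
`X₀, W₁, W₂, U₁, X₁, Y₁, U₂` are jointly Gaussian (degenerate Gaussian laws and nonzero means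
are allowed). -/
def gaussianPolicies (Q N P : ℝ) : Set Policy :=
  {π | P = ∫ ω, ω.U1 ^ 2 ∂(jointLaw Q N π) ∧
    0 ≤ (mutualInformation (jointLaw Q N π) (fun ω => (ω.W1, ω.W2)) Outcome.Y1 : EReal)
        - (condMutualInformation (jointLaw Q N π) Outcome.W2 Outcome.X0 Outcome.W1 : EReal) ∧
    IsGaussian (jointLaw Q N π)}

/-- The estimation cost `E[(X₁ - U₂)²]`. -/
noncomputable def estimationCost (Q N : ℝ) (π : Policy) : ℝ :=
  ∫ ω, (ω.X1 - ω.U2) ^ 2 ∂(jointLaw Q N π)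

/-- The optimal Gaussian estimation cost `S_G(P)`. -/
noncomputable def optimalGaussianCost (Q N P : ℝ) : ℝ :=
  sInf (estimationCost Q N '' gaussianPolicies Q N P)

/-- The best linear cost `S_ℓ(P)`. -/
noncomputable def bestLinearCost (Q N P : ℝ) : ℝ :=
  if P ∈ Set.Icc 0 Q then
    (√Q - √P) ^ 2 * N / ((√Q - √P) ^ 2 + N)
  else 0

/-- The time-sharing point `P₁`. -/
noncomputable def P₁ (Q N : ℝ) : ℝ := (Q - 2 * N - √(Q ^ 2 - 4 * Q * N)) / 2

/-- The time-sharing point `P₂`. -/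
noncomputable def P₂ (Q N : ℝ) : ℝ := (Q - 2 * N + √(Q ^ 2 - 4 * Q * N)) / 2

/-- `g` is the convex envelope of `f` on the convex set `s`: the greatest convex function on `s`
that lies below `f` on `s`. -/
def IsConvexEnvelopeOn (s : Set ℝ) (f g : ℝ → ℝ) : Prop :=
  ConvexOn ℝ s g ∧ (∀ x ∈ s, g x ≤ f x) ∧
    ∀ h : ℝ → ℝ, ConvexOn ℝ s h → (∀ x ∈ s, h x ≤ f x) → ∀ x ∈ s, h x ≤ g x

end Witsenhausen

/-! Only second moments matter. Regress `U₁ = a X₀ + b W₁ + V` and `X₀ = c₁ W₁ + c₂ W₂ + R`, and put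
`α = a + 1`, `β = b² Var W₁`, `v = Var V`, `T = Var R`. Since `W₁` is independent of `X₀`, the
subtracted term `I(W₂; X₀ | W₁)` equals `I(W₁, W₂; X₀)`. By the Gaussian formula `½ log (variance /
residual variance)`, the information constraint becomes `Q (α² T + v + N) ≤ T (α² Q + β + v + N)`,
that is `Q (v + N) ≤ T (β + v + N)` (`IsRegression.information_constraint`). Given `(W₁, W₂)`, the
decoder sees `α R + V` through noise of variance `N`, so the cost is at least `D N / (D + N)` with
`D = α² T + v` (`IsRegression.mmse_le_cov`).

With `(α - 1)² Q + β + v ≤ P`, the best choice is `v = 0`, all remaining power in `β`, and a tight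
constraint. This leaves one parameter `s = √Q α`, the feasibility condition `(√Q - s)² ≤ P`, and the
cost `slopeCost` (`slopeCost_le_of_constraint`). The policies `linearPolicy` attain every such
value.

It remains to minimize over `s`. The stationary point `s = (Q - N - P) / √Q` is feasible iff `(P +
N)² ≤ Q P`, and gives the affine branch. Otherwise the minimum is at the linear strategy `s = √Q -
√P`, or at `s = 0` if `P > Q`. Moreover `slopeCost` is the perspective of a square composed with an
affine map, hence jointly convex in `(P, s)`, and the feasible region is convex; so the minimum is
convex in `P`. It lies below the best linear cost, agrees with it outside `(P₁, P₂)` and is a chord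
of it in between, which makes it the convex envelope. -/

section KullbackLeibler

/-! ### Mutual information of Gaussian variables -/

/-- The Kullback-Leibler divergence of a probability measure with an everywhere positive density
`exp g` is the mean of `g`. -/
theorem klDiv_withDensity_exp {α : Type*} [MeasurableSpace α] {ν : Measure α}
    [IsProbabilityMeasure ν] {g : α → ℝ} (hg : Measurable g)
    [IsProbabilityMeasure (ν.withDensity fun x => ENNReal.ofReal (Real.exp (g x)))]
    (hint : Integrable g (ν.withDensity fun x => ENNReal.ofReal (Real.exp (g x)))) :
    InformationTheory.klDiv (ν.withDensity fun x => ENNReal.ofReal (Real.exp (g x))) ν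
      = ENNReal.ofReal (∫ x, g x ∂(ν.withDensity fun x => ENNReal.ofReal (Real.exp (g x)))) := by
  set μ := ν.withDensity fun x => ENNReal.ofReal (Real.exp (g x)) with hμ
  have hac : μ ≪ ν := withDensity_absolutelyContinuous _ _
  have hllr : llr μ ν =ᵐ[μ] g := by
    filter_upwards [hac.ae_le (Measure.rnDeriv_withDensity ν
      (f := fun x => ENNReal.ofReal (Real.exp (g x))) (by fun_prop))] with x hx
    simp only [llr]
    rw [hμ, hx, ENNReal.toReal_ofReal (Real.exp_pos _).le, Real.log_exp]
  rw [InformationTheory.klDiv_of_ac_of_integrable hac (hint.congr hllr.symm),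
    integral_congr_ae hllr]
  simp

/-- Data processing, applied to `e` and to its inverse. -/
theorem klDiv_map_measurableEquiv {α β : Type*} [MeasurableSpace α] [MeasurableSpace β]
    (μ ν : Measure α) [IsFiniteMeasure μ] [IsFiniteMeasure ν] (e : α ≃ᵐ β) :
    InformationTheory.klDiv (μ.map e) (ν.map e) = InformationTheory.klDiv μ ν := by
  refine le_antisymm (InformationTheory.klDiv_map_le μ ν e.measurable) ?_
  have h := InformationTheory.klDiv_map_le (μ.map e) (ν.map e) e.symm.measurable
  simpa [Measure.map_map e.symm.measurable e.measurable] using h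

/-- If `A` is independent of `C`, then `I(B; A | C) = I(C, B; A)`. -/
theorem condMutualInformation_eq_mutualInformation_of_indepFun {Ω α β γ : Type*}
    [MeasurableSpace Ω] [MeasurableSpace α] [StandardBorelSpace α] [Nonempty α]
    [MeasurableSpace β] [StandardBorelSpace β] [Nonempty β] [MeasurableSpace γ]
    (μ : Measure Ω) [IsProbabilityMeasure μ] {A : Ω → α} {B : Ω → β} {C : Ω → γ}
    (hA : Measurable A) (hB : Measurable B) (hC : Measurable C) (hind : IndepFun C A μ) :
    condMutualInformation μ B A C = mutualInformation μ (fun ω => (C ω, B ω)) A := by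
  unfold condMutualInformation mutualInformation
  have : IsProbabilityMeasure (μ.map A) := Measure.isProbabilityMeasure_map hA.aemeasurable
  have : IsProbabilityMeasure (μ.map C) := Measure.isProbabilityMeasure_map hC.aemeasurable
  have hconst : condDistrib A C μ =ᵐ[μ.map C] Kernel.const γ (μ.map A) := by
    refine condDistrib_ae_eq_of_measure_eq_compProd C hA.aemeasurable ?_
    rw [Measure.compProd_const,
      (indepFun_iff_map_prod_eq_prod_map_map hC.aemeasurable hA.aemeasurable).1 hind]
  have hprod : (condDistrib B C μ).prod (condDistrib A C μ)
      =ᵐ[μ.map C] (condDistrib B C μ).prod (Kernel.const γ (μ.map A)) := by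
    filter_upwards [hconst] with c hc
    simp [Kernel.prod_apply, hc]
  rw [Measure.compProd_congr hprod, ← klDiv_map_measurableEquiv _ _ MeasurableEquiv.prodAssoc.symm]
  congr 1
  · rw [Measure.map_map (MeasurableEquiv.measurable _) (by fun_prop)]
    rfl
  · rw [← compProd_map_condDistrib (X := C) (Y := B) hB.aemeasurable]
    refine Measure.ext_of_lintegral _ fun f hf => ?_
    rw [lintegral_map hf (MeasurableEquiv.measurable _), Measure.lintegral_compProd
      (by fun_prop), lintegral_prod _ hf.aemeasurable, Measure.lintegral_compProd (by fun_prop)]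
    refine lintegral_congr fun c => ?_
    rw [Kernel.prod_apply, lintegral_prod _ (by fun_prop)]
    simp [MeasurableEquiv.prodAssoc]

/-- If `B` has no atoms and is a function of `A`, then `I(A; B) = ∞`. -/
theorem mutualInformation_eq_top_of_ae_eq_comp {Ω α : Type*} [MeasurableSpace Ω]
    [MeasurableSpace α] (μ : Measure Ω) [IsProbabilityMeasure μ] {A : Ω → α} {B : Ω → ℝ}
    (hA : Measurable A) (hB : Measurable B) {f : α → ℝ} (hf : Measurable f)
    (hBf : B =ᵐ[μ] fun ω => f (A ω)) [NullSingletonClass (μ.map B)] :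
    mutualInformation μ A B = ∞ := by
  refine InformationTheory.klDiv_of_not_ac fun hac => ?_
  have : IsProbabilityMeasure (μ.map B) := Measure.isProbabilityMeasure_map hB.aemeasurable
  have hS : MeasurableSet {p : α × ℝ | p.2 = f p.1} :=
    measurableSet_eq_fun (by fun_prop) (by fun_prop)
  -- The graph of `f` carries all of the joint law, but each of its fibres is a single point, which
  -- the law of `B` does not charge.
  have h0 : ((μ.map A).prod (μ.map B)) {p : α × ℝ | p.2 = f p.1} = 0 := by
    rw [Measure.prod_apply hS]
    simp [Set.preimage]
  have h1 := hac h0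
  rw [Measure.map_apply (by fun_prop) hS] at h1
  have h2 : μ {ω | B ω = f (A ω)}ᶜ = 0 := hBf
  have h3 : μ (Set.univ : Set Ω) = 0 := by
    rw [← Set.union_compl_self {ω | B ω = f (A ω)}]
    exact measure_union_null h1 h2
  simp at h3

/-- The ratio of the normalizing constants is moved into the exponent, so that the density ratio has
the form `exp g` required by `klDiv_withDensity_exp`. -/
theorem gaussianPDFReal_eq_exp_mul {m m' : ℝ} {v v' : NNReal} (hv : v ≠ 0) (hv' : v' ≠ 0)
    (x : ℝ) :
    gaussianPDFReal m v x = Real.exp (Real.log (v' / v) / 2 - (x - m) ^ 2 / (2 * v)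
      + (x - m') ^ 2 / (2 * v')) * gaussianPDFReal m' v' x := by
  have h1 : (0 : ℝ) < v := by positivity
  have h2 : (0 : ℝ) < v' := by positivity
  have hs : Real.exp (Real.log ((v' : ℝ) / v) / 2) = √v' / √v := by
    rw [← Real.sqrt_div' _ h1.le, Real.sqrt_eq_rpow, Real.rpow_def_of_pos (by positivity)]
    congr 1
    ring
  have he : Real.exp (Real.log ((v' : ℝ) / v) / 2 - (x - m) ^ 2 / (2 * v)
      + (x - m') ^ 2 / (2 * v')) * Real.exp (-(x - m') ^ 2 / (2 * v'))
      = √v' / √v * Real.exp (-(x - m) ^ 2 / (2 * v)) := by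
    rw [← hs, ← Real.exp_add, ← Real.exp_add]
    congr 1
    ring
  rw [gaussianPDFReal, gaussianPDFReal, mul_left_comm, he,
    Real.sqrt_mul (x := 2 * Real.pi) (by positivity),
    Real.sqrt_mul (x := 2 * Real.pi) (by positivity)]
  have h5 : 0 < √(2 * Real.pi) := by positivity
  have h3 : 0 < √(v : ℝ) := by positivity
  have h4 : 0 < √(v' : ℝ) := by positivity
  field_simp

/-- Mutual information between `A` and a Gaussian `B = L(A) + R`, with a Gaussian `R` independent
of `A`. -/
theorem mutualInformation_eq_of_gaussian_residual {Ω α : Type*} [MeasurableSpace Ω]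
    [MeasurableSpace α] (μ : Measure Ω) [IsProbabilityMeasure μ] {A : Ω → α} {B R : Ω → ℝ}
    (hA : Measurable A) (hB : Measurable B) (hR : Measurable R) {f : α → ℝ} (hf : Measurable f)
    (hBR : ∀ ω, B ω = f (A ω) + R ω) (hind : IndepFun A R μ)
    (hGR : HasGaussianLaw R μ) (hGB : HasGaussianLaw B μ)
    (hvR : 0 < Var[R; μ]) (hvB : 0 < Var[B; μ]) :
    mutualInformation μ A B = ENNReal.ofReal (Real.log (Var[B; μ] / Var[R; μ]) / 2) := by
  have : IsProbabilityMeasure (μ.map A) := Measure.isProbabilityMeasure_map hA.aemeasurable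
  have : IsProbabilityMeasure (μ.map B) := Measure.isProbabilityMeasure_map hB.aemeasurable
  have hτ : Var[R; μ].toNNReal ≠ 0 := by simpa using hvR
  have hσ : Var[B; μ].toNNReal ≠ 0 := by simpa using hvB
  -- The log-density of the conditional law of `B` given `A = a`, which is Gaussian with mean `μ[R]
  -- + f a` and variance `Var[R; μ]`, relative to the marginal law of `B`.
  set g : α × ℝ → ℝ := fun p => Real.log (Var[B; μ].toNNReal / Var[R; μ].toNNReal) / 2
    - (p.2 - (μ[R] + f p.1)) ^ 2 / (2 * Var[R; μ].toNNReal)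
    + (p.2 - μ[B]) ^ 2 / (2 * Var[B; μ].toNNReal) with hgdef
  have hg : Measurable g := by fun_prop
  have hP : μ.map (fun ω => (A ω, B ω))
      = ((μ.map A).prod (μ.map B)).withDensity fun x => ENNReal.ofReal (Real.exp (g x)) := by
    have h1 : μ.map (fun ω => (A ω, B ω))
        = ((μ.map A).prod (μ.map R)).map (fun p => (p.1, f p.1 + p.2)) := by
      rw [← (indepFun_iff_map_prod_eq_prod_map_map hA.aemeasurable hR.aemeasurable).1 hind,
        Measure.map_map (by fun_prop) (by fun_prop)]
      congr 1
      ext ω <;> simp [hBR]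
    refine Measure.ext_of_lintegral _ fun h hh => ?_
    rw [h1, lintegral_map hh (by fun_prop), lintegral_withDensity_eq_lintegral_mul _ (by fun_prop)
      hh, hGR.map_eq_gaussianReal, hGB.map_eq_gaussianReal, lintegral_prod _ (by fun_prop),
      lintegral_prod _ (by fun_prop)]
    refine lintegral_congr fun a => ?_
    have h2 : ∫⁻ r, h (a, f a + r) ∂(gaussianReal μ[R] Var[R; μ].toNNReal)
        = ∫⁻ b, h (a, b) ∂(gaussianReal (μ[R] + f a) Var[R; μ].toNNReal) := by
      rw [← gaussianReal_map_const_add, lintegral_map (by fun_prop) (by fun_prop)]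
    rw [h2, gaussianReal_of_var_ne_zero _ hτ, gaussianReal_of_var_ne_zero _ hσ,
      lintegral_withDensity_eq_lintegral_mul _ (measurable_gaussianPDF _ _) (by fun_prop),
      lintegral_withDensity_eq_lintegral_mul _ (measurable_gaussianPDF _ _) (by fun_prop)]
    refine lintegral_congr fun b => ?_
    simp only [Pi.mul_apply, gaussianPDF]
    rw [gaussianPDFReal_eq_exp_mul hτ hσ (m' := μ[B]), ENNReal.ofReal_mul (Real.exp_pos _).le]
    simp only [hgdef]
    ring
  have : IsProbabilityMeasure
      (((μ.map A).prod (μ.map B)).withDensity fun x => ENNReal.ofReal (Real.exp (g x))) :=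
    hP ▸ Measure.isProbabilityMeasure_map (by fun_prop)
  have hR2 := hGR.memLp_two
  have hB2 := hGB.memLp_two
  have hiR : Integrable (fun ω => (R ω - μ[R]) ^ 2) μ :=
    (hR2.sub (memLp_const _)).integrable_sq
  have hiB : Integrable (fun ω => (B ω - μ[B]) ^ 2) μ :=
    (hB2.sub (memLp_const _)).integrable_sq
  -- Along `(A, B)` both quadratic terms are centred squares over twice their own variance. Their
  -- means are both `1/2` and cancel, so only the logarithm survives.
  have hgc : ∀ ω, g (A ω, B ω) = Real.log (Var[B; μ] / Var[R; μ]) / 2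
      - (R ω - μ[R]) ^ 2 / (2 * Var[R; μ]) + (B ω - μ[B]) ^ 2 / (2 * Var[B; μ]) := by
    intro ω
    simp only [hgdef, Real.coe_toNNReal _ hvR.le, Real.coe_toNNReal _ hvB.le]
    rw [hBR]
    ring_nf
  have hgi : Integrable (fun ω => g (A ω, B ω)) μ := by
    simp_rw [hgc]
    exact ((integrable_const _).sub (hiR.div_const _)).add (hiB.div_const _)
  unfold mutualInformation
  rw [hP, klDiv_withDensity_exp hg, ← hP, integral_map (by fun_prop) hg.aestronglyMeasurable]
  · congr 1
    simp_rw [hgc]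
    have h1 : Integrable (fun ω => (R ω - μ[R]) ^ 2 / (2 * Var[R; μ])) μ := hiR.div_const _
    have h2 : Integrable (fun ω => (B ω - μ[B]) ^ 2 / (2 * Var[B; μ])) μ := hiB.div_const _
    have h3 : Integrable (fun ω => Real.log (Var[B; μ] / Var[R; μ]) / 2
        - (R ω - μ[R]) ^ 2 / (2 * Var[R; μ])) μ := (integrable_const _).sub h1
    rw [integral_add h3 h2, integral_sub (integrable_const _) h1, integral_div _ fun ω => (R ω - μ[R]) ^ 2,
      integral_div _ fun ω => (B ω - μ[B]) ^ 2,
      ← variance_eq_integral hR.aemeasurable, ← variance_eq_integral hB.aemeasurable]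
    simp
    field_simp
    ring
  · rw [← hP]
    exact (integrable_map_measure hg.aestronglyMeasurable (by fun_prop)).2 hgi

end KullbackLeibler

/-- Under `ρ ⊗ κ(f ·)`, a variable that is independent of `f` is uncorrelated with the output of
the kernel. -/
theorem covariance_compProd_comap_eq_zero {α β : Type*} [MeasurableSpace α] [MeasurableSpace β]
    (ρ : Measure α) [IsProbabilityMeasure ρ] (κ : Kernel β ℝ) [IsMarkovKernel κ] {f : α → β}
    (hf : Measurable f) {R : α → ℝ} (hind : IndepFun R f ρ)
    (hR2 : MemLp (fun p : α × ℝ => R p.1) 2 (ρ.compProd (κ.comap f hf)))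
    (hU2 : MemLp (fun p : α × ℝ => p.2) 2 (ρ.compProd (κ.comap f hf))) (hR : Measurable R) :
    cov[fun p : α × ℝ => R p.1, fun p : α × ℝ => p.2; ρ.compProd (κ.comap f hf)] = 0 := by
  rw [covariance_eq_sub hR2 hU2]
  -- The conditional mean of the output. The mixed moment only sees this function of `f`, which is
  -- independent of `R`.
  have hk : Measurable fun b => ∫ u, u ∂κ b :=
    (StronglyMeasurable.integral_kernel stronglyMeasurable_id).measurable
  have h1 : ∫ p, ((fun p : α × ℝ => R p.1) * fun p : α × ℝ => p.2) p
      ∂(ρ.compProd (κ.comap f hf)) = ∫ a, (R * ((fun b => ∫ u, u ∂κ b) ∘ f)) a ∂ρ := by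
    rw [Measure.integral_compProd (hR2.integrable_mul hU2)]
    simp only [Pi.mul_apply, Kernel.comap_apply, Function.comp_apply]
    exact integral_congr_ae (.of_forall fun a => integral_const_mul _ _)
  have h2 : IndepFun R ((fun b => ∫ u, u ∂κ b) ∘ f) ρ := hind.comp measurable_id hk
  rw [h1, h2.integral_mul_eq_mul_integral hR.aestronglyMeasurable
    (hk.comp hf).aestronglyMeasurable,
    Measure.integral_compProd (hR2.integrable (by norm_num)),
    Measure.integral_compProd (hU2.integrable (by norm_num))]
  simp [Kernel.comap_apply]

/-! ### The scalar optimization over the slope, and the convex envelope -/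

namespace Witsenhausen

/-- The least estimation cost of a policy with `√Q · α = s`, where `X₁ = α X₀ + ⋯`. -/
noncomputable def slopeCost (Q N P s : ℝ) : ℝ := s ^ 2 * N / (P - Q + N + 2 * √Q * s)

open Classical in
/-- The closed form of the optimal Gaussian cost. -/
noncomputable def gaussianCostFormula (Q N P : ℝ) : ℝ :=
  if 4 * N < Q ∧ P ∈ Set.Icc (P₁ Q N) (P₂ Q N) then N * (Q - N - P) / Q
  else bestLinearCost Q N P

variable {Q N P : ℝ}

/-- `P₁` and `P₂` are the roots of `(P + N)² = Q P`. -/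
theorem mem_Icc_timeSharing_iff (hQ : 0 < Q) (hQN : 4 * N < Q) :
    P ∈ Set.Icc (P₁ Q N) (P₂ Q N) ↔ (P + N) ^ 2 ≤ Q * P := by
  have h0 : 0 ≤ Q ^ 2 - 4 * Q * N := by nlinarith
  have h1 := Real.sq_sqrt h0
  have h2 := Real.sqrt_nonneg (Q ^ 2 - 4 * Q * N)
  unfold P₁ P₂
  set r := √(Q ^ 2 - 4 * Q * N)
  have h3 : (P + N) ^ 2 - Q * P = (P - (Q - 2 * N - r) / 2) * (P - (Q - 2 * N + r) / 2) := by
    linear_combination (1 / 4) * h1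
  constructor
  · rintro ⟨h4, h5⟩
    nlinarith [mul_nonneg (sub_nonneg.2 h4) (sub_nonneg.2 h5)]
  · intro h
    constructor <;> by_contra! h4 <;> nlinarith

theorem lt_sq_of_not_timeSharing (hQ : 0 < Q)
    (h : ¬ (4 * N < Q ∧ P ∈ Set.Icc (P₁ Q N) (P₂ Q N))) : Q * P ≤ (P + N) ^ 2 ∨ P < 0 := by
  by_cases hQN : 4 * N < Q
  · rw [mem_Icc_timeSharing_iff hQ hQN] at h
    left
    have := not_and.1 h hQN
    linarith
  · rcases lt_or_ge P 0 with h | h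
    · exact .inr h
    · left
      -- `(P + N)² ≥ 4 N P ≥ Q P`.
      nlinarith [sq_nonneg (P - N), mul_nonneg h (sub_nonneg.2 (not_lt.1 hQN))]

/-- The denominator is `(P - (√Q - s)²) + s² + N`. -/
theorem slopeCost_den_pos (hQ : 0 < Q) (hN : 0 < N) {s : ℝ} (hs : (√Q - s) ^ 2 ≤ P) :
    0 < P - Q + N + 2 * √Q * s := by
  have := Real.sq_sqrt hQ.le
  nlinarith [sq_nonneg s]

theorem gaussianCostFormula_le_slopeCost (hQ : 0 < Q) (hN : 0 < N) {s : ℝ}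
    (hs : (√Q - s) ^ 2 ≤ P) : gaussianCostFormula Q N P ≤ slopeCost Q N P s := by
  have hden := slopeCost_den_pos hQ hN hs
  have hq := Real.sq_sqrt hQ.le
  have hq0 : 0 < √Q := Real.sqrt_pos.2 hQ
  have hP : 0 ≤ P := (sq_nonneg _).trans hs
  unfold gaussianCostFormula slopeCost
  split_ifs with h
  · rw [div_le_div_iff₀ hQ hden]
    -- The gap is a perfect square, vanishing exactly at the stationary point `s = (Q - N - P) /
    -- √Q`.
    have h1 : s ^ 2 * N * Q - N * (Q - N - P) * (P - Q + N + 2 * √Q * s)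
        = N * (√Q * s + (P - Q + N)) ^ 2 := by
      linear_combination (-(N * s ^ 2)) * hq
    nlinarith [mul_nonneg hN.le (sq_nonneg (√Q * s + (P - Q + N)))]
  · unfold bestLinearCost
    split_ifs with hPQ
    · have hp := Real.sq_sqrt hP
      have hp0 := Real.sqrt_nonneg P
      have hpq : √P ≤ √Q := Real.sqrt_le_sqrt hPQ.2
      have hsp : √Q - √P ≤ s := by
        have := abs_le_of_sq_le_sq (hs.trans hp.ge) hp0
        linarith [(abs_le.1 this).2]
      have hkey : √P * √Q ≤ P + N := by
        rcases lt_sq_of_not_timeSharing hQ h with h1 | h1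
        · refine abs_le_of_sq_le_sq' ?_ (by linarith) |>.2
          nlinarith
        · linarith
      rw [div_le_div_iff₀ (by positivity) hden]
      -- With `d = √Q - √P` the least feasible slope, the gap has the factor `s - d`. The cofactor
      -- increases with `s`, and at `s = d` it equals `2 d (P + N - √P √Q)`, nonnegative by `hkey`.
      have h2 : 0 ≤ (s - (√Q - √P)) * ((s + (√Q - √P)) * ((√Q - √P) ^ 2 + N)
          - 2 * √Q * (√Q - √P) ^ 2) := by
        refine mul_nonneg (sub_nonneg.2 hsp) ?_
        have h3 : 0 ≤ 2 * (√Q - √P) * ((√Q - √P) ^ 2 + N - √Q * (√Q - √P)) :=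
          mul_nonneg (by linarith) (by nlinarith)
        have h4 : 0 ≤ (s - (√Q - √P)) * ((√Q - √P) ^ 2 + N) :=
          mul_nonneg (sub_nonneg.2 hsp) (by positivity)
        nlinarith
      have h5 : s ^ 2 * N * ((√Q - √P) ^ 2 + N)
          - (√Q - √P) ^ 2 * N * (P - Q + N + 2 * √Q * s)
          = N * ((s - (√Q - √P)) * ((s + (√Q - √P)) * ((√Q - √P) ^ 2 + N)
          - 2 * √Q * (√Q - √P) ^ 2)) := by
        linear_combination ((√Q - √P) ^ 2 * N) * (hp - hq)
      nlinarith [mul_nonneg hN.le h2]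
    · positivity

theorem slopeCost_sqrt_sub_sqrt (hQ : 0 < Q) (hP : 0 ≤ P) :
    slopeCost Q N P (√Q - √P) = (√Q - √P) ^ 2 * N / ((√Q - √P) ^ 2 + N) := by
  unfold slopeCost
  congr 1
  linear_combination (-1) * Real.sq_sqrt hP - Real.sq_sqrt hQ.le + 2 * Real.sq_sqrt hQ.le

theorem exists_slopeCost_eq (hQ : 0 < Q) (hN : 0 < N) (hP : 0 ≤ P) :
    ∃ s, (√Q - s) ^ 2 ≤ P ∧ slopeCost Q N P s = gaussianCostFormula Q N P := by
  have hq := Real.sq_sqrt hQ.le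
  have hq0 : 0 < √Q := Real.sqrt_pos.2 hQ
  unfold gaussianCostFormula
  split_ifs with h
  · have h1 := (mem_Icc_timeSharing_iff hQ h.1).1 h.2
    have h2 : √Q - (Q - N - P) / √Q = (N + P) / √Q := by
      field_simp
      linarith
    have hs : (√Q - (Q - N - P) / √Q) ^ 2 ≤ P := by
      rw [h2, div_pow, hq, div_le_iff₀ hQ]
      linarith
    refine ⟨(Q - N - P) / √Q, hs, ?_⟩
    have hden := slopeCost_den_pos hQ hN hs
    have h3 : P - Q + N + 2 * √Q * ((Q - N - P) / √Q) = Q - N - P := by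
      field_simp
      ring
    rw [h3] at hden
    rw [slopeCost, h3, div_pow, hq]
    field_simp
  · unfold bestLinearCost
    split_ifs with hPQ
    · exact ⟨√Q - √P, by simp [Real.sq_sqrt hP], slopeCost_sqrt_sub_sqrt hQ hP⟩
    · refine ⟨0, ?_, by simp [slopeCost]⟩
      have : Q < P := by
        by_contra! hc
        exact hPQ ⟨hP, hc⟩
      simpa [hq] using this.le

theorem gaussianCostFormula_le_bestLinearCost (hQ : 0 < Q) (hN : 0 < N) (hP : 0 ≤ P) :
    gaussianCostFormula Q N P ≤ bestLinearCost Q N P := by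
  unfold bestLinearCost
  split_ifs with hPQ
  · rw [← slopeCost_sqrt_sub_sqrt hQ hP]
    exact gaussianCostFormula_le_slopeCost hQ hN (by simp [Real.sq_sqrt hP])
  · have : Q < P := by
      by_contra! hc
      exact hPQ ⟨hP, hc⟩
    have h := gaussianCostFormula_le_slopeCost hQ hN (P := P) (s := 0)
      (by simpa [Real.sq_sqrt hQ.le] using this.le)
    simpa [slopeCost] using h

/-- Partial minimization preserves joint convexity: mixing optimal slopes for `x` and `y` gives a
feasible slope for the mixed power. -/
theorem convexOn_gaussianCostFormula (hQ : 0 < Q) (hN : 0 < N) :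
    ConvexOn ℝ (Set.Ici 0) (gaussianCostFormula Q N) := by
  refine ⟨convex_Ici 0, fun x hx y hy a b ha hb hab => ?_⟩
  obtain ⟨s, hs, h1⟩ := exists_slopeCost_eq hQ hN hx
  obtain ⟨t, ht, h2⟩ := exists_slopeCost_eq hQ hN hy
  rw [← h1, ← h2]
  simp only [smul_eq_mul]
  have hst : (√Q - (a * s + b * t)) ^ 2 ≤ a * x + b * y := by
    obtain rfl : b = 1 - a := by linarith
    nlinarith [mul_le_mul_of_nonneg_left hs ha, mul_le_mul_of_nonneg_left ht hb,
      mul_nonneg (mul_nonneg ha hb) (sq_nonneg (s - t))]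
  refine (gaussianCostFormula_le_slopeCost hQ hN hst).trans ?_
  have d1 := slopeCost_den_pos hQ hN hs
  have d2 := slopeCost_den_pos hQ hN ht
  have d3 := slopeCost_den_pos hQ hN hst
  unfold slopeCost
  set u := x - Q + N + 2 * √Q * s with hu
  set w := y - Q + N + 2 * √Q * t with hw
  have h3 : a * x + b * y - Q + N + 2 * √Q * (a * s + b * t) = a * u + b * w := by
    obtain rfl : b = 1 - a := by linarith
    rw [hu, hw]
    ring
  rw [h3] at d3 ⊢
  rw [div_le_iff₀ d3]
  -- The exact defect in the Cauchy-Schwarz inequality `(a s + b t)² ≤ (a s² / u + b t² / w) (a u +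
  -- b w)`.
  have h4 : (a * (s ^ 2 * N / u) + b * (t ^ 2 * N / w)) * (a * u + b * w)
      - (a * s + b * t) ^ 2 * N = a * b * N * (s * w - t * u) ^ 2 / (u * w) := by
    field_simp
    ring
  have h5 : 0 ≤ a * b * N * (s * w - t * u) ^ 2 / (u * w) := by positivity
  linarith

/-- At `P₁` and `P₂` one has `√Q √P = P + N`, so the two branches agree there. -/
theorem bestLinearCost_eq_of_timeSharing (hQ : 0 < Q) (hN : 0 < N)
    (hP : (P + N) ^ 2 = Q * P) : bestLinearCost Q N P = N * (Q - N - P) / Q := by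
  have hP0 : 0 ≤ P := by
    by_contra! h
    nlinarith [sq_nonneg (P + N)]
  have hPQ : P ≤ Q - 2 * N := by nlinarith
  have h1 : √Q * √P = P + N := by
    rw [← Real.sqrt_mul hQ.le, ← hP, Real.sqrt_sq (by linarith)]
  have h2 : (√Q - √P) ^ 2 = Q - P - 2 * N := by
    linear_combination Real.sq_sqrt hQ.le + Real.sq_sqrt hP0 - 2 * h1
  rw [bestLinearCost, if_pos ⟨hP0, by linarith⟩, h2, div_eq_div_iff (by linarith) hQ.ne']
  linear_combination (-N) * hP

theorem isConvexEnvelopeOn_gaussianCostFormula (hQ : 0 < Q) (hN : 0 < N) :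
    IsConvexEnvelopeOn (Set.Ici 0) (bestLinearCost Q N) (gaussianCostFormula Q N) := by
  refine ⟨convexOn_gaussianCostFormula hQ hN,
    fun x hx => gaussianCostFormula_le_bestLinearCost hQ hN hx, fun h hconv hle x hx => ?_⟩
  unfold gaussianCostFormula
  split_ifs with hx'
  · obtain ⟨hQN, h12⟩ := hx'
    have hD : 0 ≤ Q ^ 2 - 4 * Q * N := by nlinarith
    have hle12 : P₁ Q N ≤ P₂ Q N := h12.1.trans h12.2
    have e1 : (P₁ Q N + N) ^ 2 = Q * P₁ Q N := by
      unfold P₁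
      linear_combination (1 / 4) * Real.sq_sqrt hD
    have e2 : (P₂ Q N + N) ^ 2 = Q * P₂ Q N := by
      unfold P₂
      linear_combination (1 / 4) * Real.sq_sqrt hD
    have p1 : 0 ≤ P₁ Q N := by nlinarith [sq_nonneg (P₁ Q N + N)]
    -- A convex minorant lies below the chord over `[P₁, P₂]`, and the chord is the affine branch.
    obtain ⟨a, b, ha, hb, hab, hxab⟩ := (segment_eq_Icc hle12).ge h12
    have := hconv.2 (Set.mem_Ici.2 p1) (Set.mem_Ici.2 (p1.trans hle12)) ha hb hab
    rw [hxab] at this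
    refine this.trans ?_
    have l1 := hle _ (Set.mem_Ici.2 p1)
    have l2 := hle _ (Set.mem_Ici.2 (p1.trans hle12))
    rw [bestLinearCost_eq_of_timeSharing hQ hN e1] at l1
    rw [bestLinearCost_eq_of_timeSharing hQ hN e2] at l2
    simp only [smul_eq_mul] at hxab ⊢
    refine (add_le_add (mul_le_mul_of_nonneg_left l1 ha)
      (mul_le_mul_of_nonneg_left l2 hb)).trans (le_of_eq ?_)
    rw [← hxab]
    obtain rfl : b = 1 - a := by linarith
    field_simp
    ring
  · exact hle x hx

/-- The estimation cost is at least `slopeCost` if the information constraint holds. -/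
theorem slopeCost_le_of_constraint (hQ : 0 < Q) (hN : 0 < N) {α β v T : ℝ} (hβ : 0 ≤ β)
    (hv : 0 ≤ v) (hT : 0 < T) (hP : (α - 1) ^ 2 * Q + β + v ≤ P)
    (hc : Q * (α ^ 2 * T + v + N) ≤ T * (α ^ 2 * Q + β + v + N)) :
    slopeCost Q N P (√Q * α) ≤ (α ^ 2 * T + v) * N / (α ^ 2 * T + v + N) := by
  have hq := Real.sq_sqrt hQ.le
  have h1 : (√Q * α) ^ 2 = Q * α ^ 2 := by rw [mul_pow, hq]
  have h2 : P - Q + N + 2 * √Q * (√Q * α) = (P - (α - 1) ^ 2 * Q) + α ^ 2 * Q + N := by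
    linear_combination (2 * α) * hq
  have hd : 0 < (P - (α - 1) ^ 2 * Q) + α ^ 2 * Q + N := by nlinarith [sq_nonneg α]
  rw [slopeCost, h1, h2, div_le_div_iff₀ hd (by positivity)]
  -- The terms in `α² Q T` cancel. Dropping `v` on the left and bounding `β + v` by the power left
  -- over then gives `h4`.
  have h3 : Q * (v + N) ≤ T * (β + v + N) := by linarith
  have h4 : Q * N ≤ T * (P - (α - 1) ^ 2 * Q + N) := by
    have : Q * N * (β + v + N) ≤ T * (P - (α - 1) ^ 2 * Q + N) * (β + v + N) := by
      nlinarith [mul_nonneg hQ.le hv, mul_nonneg hT.le (add_nonneg (add_nonneg hβ hv) hN.le),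
        mul_le_mul_of_nonneg_left hP (mul_nonneg hT.le (add_nonneg (add_nonneg hβ hv) hN.le)),
        mul_nonneg (mul_nonneg hQ.le hv) (add_nonneg (add_nonneg hβ hv) hN.le),
        mul_nonneg (add_nonneg (add_nonneg hβ hv) hN.le) (sub_nonneg.2 h3)]
    exact le_of_mul_le_mul_right this (by positivity)
  have h5 : α ^ 2 * Q * N ≤ (α ^ 2 * T + v) * (P - (α - 1) ^ 2 * Q + N) := by
    nlinarith [mul_le_mul_of_nonneg_left h4 (sq_nonneg α)]
  nlinarith [mul_le_mul_of_nonneg_left h5 hN.le]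

end Witsenhausen

/-! ### Regression and independence through the covariance form -/

section GaussianFunctionals

variable {E : Type*} [NormedAddCommGroup E] [NormedSpace ℝ E] [MeasurableSpace E] [BorelSpace E]

theorem covarianceBilinDual_sub_smul_sub_smul (μ : Measure E) (z x w₁ w₂ : StrongDual ℝ E)
    (c₁ c₂ : ℝ) : covarianceBilinDual μ z (x - c₁ • w₁ - c₂ • w₂)
      = covarianceBilinDual μ z x - c₁ * covarianceBilinDual μ z w₁
        - c₂ * covarianceBilinDual μ z w₂ := by
  rw [map_sub, map_sub, map_smul, map_smul, smul_eq_mul, smul_eq_mul]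

/-- Cauchy-Schwarz in its degenerate case. -/
theorem covarianceBilinDual_eq_zero_of_self_eq_zero {μ : Measure E} {z : StrongDual ℝ E}
    (hz : covarianceBilinDual μ z z = 0) (x : StrongDual ℝ E) :
    covarianceBilinDual μ x z = 0 := by
  have hp := isPosSemidef_covarianceBilinDual (μ := μ)
  have h := LinearMap.BilinForm.apply_sq_le_of_symm (covarianceBilinDual μ).toBilinForm
    (fun x => hp.nonneg x) ⟨hp.eq⟩ x z
  change (covarianceBilinDual μ x z) ^ 2 ≤
    covarianceBilinDual μ x x * covarianceBilinDual μ z z at h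
  rw [hz, mul_zero] at h
  exact pow_eq_zero_iff (two_ne_zero) |>.1 (le_antisymm h (sq_nonneg _))

/-- Existence of the linear regression of `x` on `w`. -/
theorem exists_covarianceBilinDual_sub_smul (μ : Measure E) (x w : StrongDual ℝ E) :
    ∃ c : ℝ, covarianceBilinDual μ (x - c • w) w = 0 := by
  by_cases hw : covarianceBilinDual μ w w = 0
  · exact ⟨0, covarianceBilinDual_eq_zero_of_self_eq_zero hw _⟩
  · refine ⟨covarianceBilinDual μ x w / covarianceBilinDual μ w w, ?_⟩
    simp [field]

/-- Existence of the linear regression of `x` on `w₁` and `w₂`. -/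
theorem exists_covarianceBilinDual_sub_smul_sub_smul (μ : Measure E)
    (x w₁ w₂ : StrongDual ℝ E) :
    ∃ c₁ c₂ : ℝ, covarianceBilinDual μ (x - c₁ • w₁ - c₂ • w₂) w₁ = 0 ∧
      covarianceBilinDual μ (x - c₁ • w₁ - c₂ • w₂) w₂ = 0 := by
  -- Gram-Schmidt: regress on `w₁` and on `w₂ - a • w₁`. No invertible covariance matrix is needed,
  -- so degenerate laws are covered.
  obtain ⟨a, ha⟩ := exists_covarianceBilinDual_sub_smul μ w₂ w₁
  obtain ⟨b, hb⟩ := exists_covarianceBilinDual_sub_smul μ x w₁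
  obtain ⟨c, hc⟩ := exists_covarianceBilinDual_sub_smul μ x (w₂ - a • w₁)
  have e : x - (b - c * a) • w₁ - c • w₂ = (x - b • w₁) - c • (w₂ - a • w₁) := by
    module
  have h1 : covarianceBilinDual μ (x - (b - c * a) • w₁ - c • w₂) w₁ = 0 := by
    rw [e, map_sub, map_smul, sub_apply, smul_apply, hb,
      ha, smul_zero, sub_zero]
  refine ⟨b - c * a, c, h1, ?_⟩
  have h2 : covarianceBilinDual μ (x - (b - c * a) • w₁ - c • w₂) (w₂ - a • w₁) = 0 := by
    have e' : x - (b - c * a) • w₁ - c • w₂ = (x - c • (w₂ - a • w₁)) - b • w₁ := by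
      module
    rw [e', map_sub (covarianceBilinDual μ), sub_apply, hc, map_smul (covarianceBilinDual μ),
      smul_apply, covarianceBilinDual_comm, ha, smul_zero, sub_zero]
  rwa [map_sub, map_smul, h1, smul_zero, sub_zero] at h2

theorem hasGaussianLaw_functional {μ : Measure E} [IsGaussian μ] (x : StrongDual ℝ E) : HasGaussianLaw x μ :=
  IsGaussian.hasGaussianLaw_id.map x

theorem memLp_two_functional {μ : Measure E} [IsGaussian μ] (x : StrongDual ℝ E) : MemLp x 2 μ :=
  (hasGaussianLaw_functional x).memLp_two

variable [CompleteSpace E] [SecondCountableTopology E] {μ : Measure E} [IsGaussian μ]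

theorem covarianceBilinDual_eq_cov (x y : StrongDual ℝ E) :
    covarianceBilinDual μ x y = cov[x, y; μ] :=
  covarianceBilinDual_eq_covariance IsGaussian.memLp_two_id x y

theorem covarianceBilinDual_self_eq_var (x : StrongDual ℝ E) :
    covarianceBilinDual μ x x = Var[x; μ] :=
  covarianceBilinDual_self_eq_variance IsGaussian.memLp_two_id x

theorem ae_eq_integral_of_covarianceBilinDual_self_eq_zero {x : StrongDual ℝ E}
    (hx : covarianceBilinDual μ x x = 0) : ∀ᵐ ω ∂μ, x ω = μ[x] :=
  ae_eq_integral_of_variance_eq_zero (memLp_two_functional x)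
    (by rw [← covarianceBilinDual_self_eq_var, hx])

/-- A functional that is uncorrelated with `w₁` and `w₂` is independent of the pair. -/
theorem indepFun_pair_of_covarianceBilinDual_eq_zero {r w₁ w₂ : StrongDual ℝ E}
    (h₁ : covarianceBilinDual μ r w₁ = 0) (h₂ : covarianceBilinDual μ r w₂ = 0) :
    IndepFun r (fun ω => (w₁ ω, w₂ ω)) μ := by
  refine HasGaussianLaw.indepFun_of_covariance_strongDual
    (IsGaussian.hasGaussianLaw_id.map (r.prod (w₁.prod w₂))) fun L₁ L₂ => ?_
  have e : covarianceBilinDual μ (L₁ ∘L r) (L₂ ∘L (w₁.prod w₂)) = 0 := by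
    have e1 : L₁ ∘L r = L₁ 1 • r := by
      ext ω
      have := L₁.map_smul (r ω) 1
      simp_all [mul_comm]
    have e2 : L₂ ∘L (w₁.prod w₂) = L₂ (1, 0) • w₁ + L₂ (0, 1) • w₂ := by
      ext ω
      have : (w₁ ω, w₂ ω) = w₁ ω • ((1 : ℝ), (0 : ℝ)) + w₂ ω • ((0 : ℝ), (1 : ℝ)) := by simp
      simp only [ContinuousLinearMap.comp_apply, ContinuousLinearMap.prod_apply]
      rw [this, map_add, map_smul, map_smul]
      simp [mul_comm]
    simp [e1, e2, h₁, h₂]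
  rw [covarianceBilinDual_eq_cov] at e
  exact e

/-- As `indepFun_pair_of_covarianceBilinDual_eq_zero`, for three functionals. -/
theorem indepFun_triple_of_covarianceBilinDual_eq_zero {r w₁ w₂ w₃ : StrongDual ℝ E}
    (h₁ : covarianceBilinDual μ r w₁ = 0) (h₂ : covarianceBilinDual μ r w₂ = 0)
    (h₃ : covarianceBilinDual μ r w₃ = 0) :
    IndepFun r (fun ω => (w₁ ω, w₂ ω, w₃ ω)) μ := by
  refine HasGaussianLaw.indepFun_of_covariance_strongDual
    (IsGaussian.hasGaussianLaw_id.map (r.prod (w₁.prod (w₂.prod w₃)))) fun L₁ L₂ => ?_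
  have e : covarianceBilinDual μ (L₁ ∘L r) (L₂ ∘L (w₁.prod (w₂.prod w₃))) = 0 := by
    have e1 : L₁ ∘L r = L₁ 1 • r := by
      ext ω
      have := L₁.map_smul (r ω) 1
      simp_all [mul_comm]
    have e2 : L₂ ∘L (w₁.prod (w₂.prod w₃))
        = L₂ (1, 0, 0) • w₁ + L₂ (0, 1, 0) • w₂ + L₂ (0, 0, 1) • w₃ := by
      ext ω
      have : (w₁ ω, w₂ ω, w₃ ω) = w₁ ω • ((1 : ℝ), (0 : ℝ), (0 : ℝ))
          + w₂ ω • ((0 : ℝ), (1 : ℝ), (0 : ℝ)) + w₃ ω • ((0 : ℝ), (0 : ℝ), (1 : ℝ)) := by simp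
      simp only [ContinuousLinearMap.comp_apply, ContinuousLinearMap.prod_apply]
      rw [this, map_add, map_add, map_smul, map_smul, map_smul]
      simp [mul_comm]
    simp [e1, e2, h₁, h₂, h₃]
  rw [covarianceBilinDual_eq_cov] at e
  exact e

/-- Mutual information of jointly Gaussian functionals, by the residual variance. -/
theorem mutualInformation_functional {w₁ w₂ y : StrongDual ℝ E} {c₁ c₂ : ℝ}
    (h₁ : covarianceBilinDual μ (y - c₁ • w₁ - c₂ • w₂) w₁ = 0)
    (h₂ : covarianceBilinDual μ (y - c₁ • w₁ - c₂ • w₂) w₂ = 0)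
    (hr : 0 < covarianceBilinDual μ (y - c₁ • w₁ - c₂ • w₂) (y - c₁ • w₁ - c₂ • w₂))
    (hy : 0 < covarianceBilinDual μ y y) :
    mutualInformation μ (fun ω => (w₁ ω, w₂ ω)) y
      = ENNReal.ofReal (Real.log (covarianceBilinDual μ y y /
          covarianceBilinDual μ (y - c₁ • w₁ - c₂ • w₂) (y - c₁ • w₁ - c₂ • w₂)) / 2) := by
  rw [covarianceBilinDual_self_eq_var] at hr hy
  rw [covarianceBilinDual_self_eq_var, covarianceBilinDual_self_eq_var]
  exact mutualInformation_eq_of_gaussian_residual μ (by fun_prop) (by fun_prop) (by fun_prop)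
    (f := fun p => c₁ * p.1 + c₂ * p.2) (by fun_prop) (fun ω => by simp)
    (indepFun_pair_of_covarianceBilinDual_eq_zero h₁ h₂).symm (hasGaussianLaw_functional _)
    (hasGaussianLaw_functional _) hr hy

theorem mutualInformation_functional_eq_top {w₁ w₂ y : StrongDual ℝ E} {c₁ c₂ : ℝ}
    (hr : covarianceBilinDual μ (y - c₁ • w₁ - c₂ • w₂) (y - c₁ • w₁ - c₂ • w₂) = 0)
    (hy : 0 < covarianceBilinDual μ y y) :
    mutualInformation μ (fun ω => (w₁ ω, w₂ ω)) y = ∞ := by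
  have : NullSingletonClass (μ.map y) := by
    rw [(hasGaussianLaw_functional y).map_eq_gaussianReal]
    refine nullSingletonClass_gaussianReal ?_
    rw [covarianceBilinDual_self_eq_var] at hy
    simpa using hy
  refine mutualInformation_eq_top_of_ae_eq_comp μ (by fun_prop) (by fun_prop)
    (f := fun p => c₁ * p.1 + c₂ * p.2 + μ[y - c₁ • w₁ - c₂ • w₂]) (by fun_prop) ?_
  filter_upwards [ae_eq_integral_of_covarianceBilinDual_self_eq_zero hr] with ω hω
  rw [← hω]
  simp

end GaussianFunctionals

/-- A function of `X` that is independent of `f(X)` is uncorrelated with `U`, if `U` is drawn from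
a kernel that depends on `f(X)` only. -/
theorem covariance_eq_zero_of_map_eq_compProd {Ω α β : Type*} [MeasurableSpace Ω]
    [MeasurableSpace α] [MeasurableSpace β] {μ : Measure Ω} [IsProbabilityMeasure μ] {X : Ω → α}
    {U : Ω → ℝ} (hX : Measurable X) (hU : Measurable U) {ρ : Measure α} [IsProbabilityMeasure ρ]
    {κ : Kernel β ℝ} [IsMarkovKernel κ] {f : α → β} (hf : Measurable f)
    (hlaw : μ.map (fun ω => (X ω, U ω)) = ρ.compProd (κ.comap f hf)) {R : α → ℝ}
    (hR : Measurable R) (hind : IndepFun (fun ω => R (X ω)) (fun ω => f (X ω)) μ)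
    (hR2 : MemLp (fun ω => R (X ω)) 2 μ) (hU2 : MemLp U 2 μ) :
    cov[fun ω => R (X ω), U; μ] = 0 := by
  have hρ : ρ = μ.map X := by
    rw [← Measure.fst_compProd ρ (κ.comap f hf), ← hlaw, Measure.fst_map_prodMk hU]
  have hind' : IndepFun R f ρ := by
    rw [indepFun_iff_map_prod_eq_prod_map_map (by fun_prop) (by fun_prop)] at hind ⊢
    rw [hρ, Measure.map_map (by fun_prop) (by fun_prop), Measure.map_map (by fun_prop) (by fun_prop),
      Measure.map_map (by fun_prop) (by fun_prop)]
    exact hind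
  have hXU : AEMeasurable (fun ω => (X ω, U ω)) μ := by fun_prop
  have hR' : Measurable fun p : α × ℝ => R p.1 := by fun_prop
  have h := covariance_compProd_comap_eq_zero ρ κ hf hind' (R := R) ?_ ?_ hR
  · rw [← hlaw, covariance_map_fun hR'.aestronglyMeasurable (by fun_prop) hXU] at h
    exact h
  · rw [← hlaw, memLp_map_measure_iff hR'.aestronglyMeasurable hXU]
    exact hR2
  · rw [← hlaw, memLp_map_measure_iff (by fun_prop) (by fun_prop)]
    exact hU2

/-! ### The joint law: marginals, independence and covariances -/

namespace Witsenhausen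

namespace Outcome

theorem measurable_X0 : Measurable X0 := by unfold X0; fun_prop
theorem measurable_W1 : Measurable W1 := by unfold W1; fun_prop
theorem measurable_W2 : Measurable W2 := by unfold W2; fun_prop

end Outcome

/-! The coordinates of the outcome as continuous linear functionals. -/

/-- `X₀` -/
noncomputable def x0 : StrongDual ℝ Outcome :=
  .fst ℝ ℝ ℝ ∘L .fst ℝ (ℝ × ℝ) (ℝ × ℝ) ∘L .fst ℝ ((ℝ × ℝ) × (ℝ × ℝ)) (ℝ × ℝ) ∘L
    .fst ℝ (((ℝ × ℝ) × (ℝ × ℝ)) × (ℝ × ℝ)) ℝ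
/-- `W₁` -/
noncomputable def w1 : StrongDual ℝ Outcome :=
  .snd ℝ ℝ ℝ ∘L .fst ℝ (ℝ × ℝ) (ℝ × ℝ) ∘L .fst ℝ ((ℝ × ℝ) × (ℝ × ℝ)) (ℝ × ℝ) ∘L
    .fst ℝ (((ℝ × ℝ) × (ℝ × ℝ)) × (ℝ × ℝ)) ℝ
/-- `W₂` -/
noncomputable def w2 : StrongDual ℝ Outcome :=
  .fst ℝ ℝ ℝ ∘L .snd ℝ (ℝ × ℝ) (ℝ × ℝ) ∘L .fst ℝ ((ℝ × ℝ) × (ℝ × ℝ)) (ℝ × ℝ) ∘L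
    .fst ℝ (((ℝ × ℝ) × (ℝ × ℝ)) × (ℝ × ℝ)) ℝ
/-- `U₁` -/
noncomputable def u1 : StrongDual ℝ Outcome :=
  .snd ℝ ℝ ℝ ∘L .snd ℝ (ℝ × ℝ) (ℝ × ℝ) ∘L .fst ℝ ((ℝ × ℝ) × (ℝ × ℝ)) (ℝ × ℝ) ∘L
    .fst ℝ (((ℝ × ℝ) × (ℝ × ℝ)) × (ℝ × ℝ)) ℝ
/-- `X₁` -/
noncomputable def x1 : StrongDual ℝ Outcome :=
  .fst ℝ ℝ ℝ ∘L .snd ℝ ((ℝ × ℝ) × (ℝ × ℝ)) (ℝ × ℝ) ∘L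
    .fst ℝ (((ℝ × ℝ) × (ℝ × ℝ)) × (ℝ × ℝ)) ℝ
/-- `Y₁` -/
noncomputable def y1 : StrongDual ℝ Outcome :=
  .snd ℝ ℝ ℝ ∘L .snd ℝ ((ℝ × ℝ) × (ℝ × ℝ)) (ℝ × ℝ) ∘L
    .fst ℝ (((ℝ × ℝ) × (ℝ × ℝ)) × (ℝ × ℝ)) ℝ
/-- `U₂` -/
noncomputable def u2 : StrongDual ℝ Outcome :=
  .snd ℝ (((ℝ × ℝ) × (ℝ × ℝ)) × (ℝ × ℝ)) ℝ

@[simp] theorem x0_apply (ω : Outcome) : x0 ω = ω.1.1.1.1 := rfl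
@[simp] theorem w1_apply (ω : Outcome) : w1 ω = ω.1.1.1.2 := rfl
@[simp] theorem w2_apply (ω : Outcome) : w2 ω = ω.1.1.2.1 := rfl
@[simp] theorem u1_apply (ω : Outcome) : u1 ω = ω.1.1.2.2 := rfl
@[simp] theorem x1_apply (ω : Outcome) : x1 ω = ω.1.2.1 := rfl
@[simp] theorem y1_apply (ω : Outcome) : y1 ω = ω.1.2.2 := rfl
@[simp] theorem u2_apply (ω : Outcome) : u2 ω = ω.2 := rfl

section JointLaw

variable {Q N : ℝ} {π : Policy}

/-- The channel adds independent Gaussian noise. -/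
theorem map_fst_jointLaw (Q N : ℝ) (π : Policy) :
    (jointLaw Q N π).map (fun ω => ω.1) =
      ((((gaussianReal 0 Q.toNNReal).prod π.lawW1).compProd (π.kerW2.prod π.kerU1)).prod
        (gaussianReal 0 N.toNNReal)).map
        (fun p => (p.1, (p.1.1.1 + p.1.2.2, p.1.1.1 + p.1.2.2 + p.2))) := by
  have h : (jointLaw Q N π).map (fun ω => ω.1) = _ := Measure.fst_compProd _ _
  rw [h]
  refine Measure.ext_of_lintegral _ fun f hf => ?_
  rw [lintegral_map hf (by fun_prop), Measure.lintegral_compProd hf,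
    lintegral_prod _ (by fun_prop)]
  refine lintegral_congr fun a => ?_
  rw [Kernel.comap_apply, channel, Kernel.map_apply _ (by fun_prop),
    lintegral_map (by fun_prop) (by fun_prop), Kernel.prod_apply, lintegral_prod _ (by fun_prop),
    Kernel.id_apply, lintegral_dirac' _ (by fun_prop), Kernel.const_apply]

theorem map_input_jointLaw (Q N : ℝ) (π : Policy) :
    (jointLaw Q N π).map (fun ω => ω.1.1) =
      ((gaussianReal 0 Q.toNNReal).prod π.lawW1).compProd (π.kerW2.prod π.kerU1) := by
  have h : (jointLaw Q N π).map (fun ω => ω.1.1)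
      = ((jointLaw Q N π).map (fun ω => ω.1)).map (fun p => p.1) := by
    rw [Measure.map_map (by fun_prop) (by fun_prop)]
    rfl
  rw [h, map_fst_jointLaw, Measure.map_map (by fun_prop) (by fun_prop)]
  exact Measure.fst_prod

theorem map_X0_W1_jointLaw (Q N : ℝ) (π : Policy) :
    (jointLaw Q N π).map (fun ω => ω.1.1.1) = (gaussianReal 0 Q.toNNReal).prod π.lawW1 := by
  have h : (jointLaw Q N π).map (fun ω => ω.1.1.1)
      = ((jointLaw Q N π).map (fun ω => ω.1.1)).map (fun p => p.1) := by
    rw [Measure.map_map (by fun_prop) (by fun_prop)]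
    rfl
  rw [h, map_input_jointLaw]
  exact Measure.fst_compProd _ _

theorem map_X0_jointLaw (Q N : ℝ) (π : Policy) :
    (jointLaw Q N π).map x0 = gaussianReal 0 Q.toNNReal := by
  have h : (jointLaw Q N π).map x0
      = ((jointLaw Q N π).map (fun ω => ω.1.1.1)).map (fun p => p.1) := by
    rw [Measure.map_map (by fun_prop) (by fun_prop)]
    rfl
  rw [h, map_X0_W1_jointLaw]
  exact Measure.fst_prod

theorem map_W1_jointLaw (Q N : ℝ) (π : Policy) :
    (jointLaw Q N π).map w1 = π.lawW1 := by
  have h : (jointLaw Q N π).map w1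
      = ((jointLaw Q N π).map (fun ω => ω.1.1.1)).map (fun p => p.2) := by
    rw [Measure.map_map (by fun_prop) (by fun_prop)]
    rfl
  rw [h, map_X0_W1_jointLaw]
  exact Measure.snd_prod

theorem indepFun_W1_X0 : IndepFun w1 x0 (jointLaw Q N π) := by
  refine IndepFun.symm ?_
  rw [indepFun_iff_map_prod_eq_prod_map_map (by fun_prop) (by fun_prop), map_X0_jointLaw,
    map_W1_jointLaw, ← map_X0_W1_jointLaw Q N π]
  rfl

theorem ae_X1_eq : ∀ᵐ ω ∂(jointLaw Q N π), x1 ω = x0 ω + u1 ω := by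
  have h : ∀ᵐ p ∂((jointLaw Q N π).map (fun ω => ω.1)), p.2.1 = p.1.1.1 + p.1.2.2 := by
    rw [map_fst_jointLaw, ae_map_iff (by fun_prop)
      (measurableSet_eq_fun (by fun_prop) (by fun_prop))]
    simp
  exact ae_of_ae_map (by fun_prop) h

theorem map_input_noise_jointLaw (Q N : ℝ) (π : Policy) :
    (jointLaw Q N π).map (fun ω => (ω.1.1, (y1 - x1) ω)) =
      ((jointLaw Q N π).map (fun ω => ω.1.1)).prod (gaussianReal 0 N.toNNReal) := by
  have h : (jointLaw Q N π).map (fun ω => (ω.1.1, (y1 - x1) ω))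
      = ((jointLaw Q N π).map (fun ω => ω.1)).map (fun p => (p.1, p.2.2 - p.2.1)) := by
    rw [Measure.map_map (by fun_prop) (by fun_prop)]
    rfl
  rw [h, map_fst_jointLaw, map_input_jointLaw, Measure.map_map (by fun_prop) (by fun_prop)]
  convert Measure.map_id
  ext p <;> simp

theorem map_noise_jointLaw (Q N : ℝ) (π : Policy) :
    (jointLaw Q N π).map (y1 - x1) = gaussianReal 0 N.toNNReal := by
  have h : (jointLaw Q N π).map (y1 - x1)
      = ((jointLaw Q N π).map (fun ω => (ω.1.1, (y1 - x1) ω))).map (fun p => p.2) := by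
    rw [Measure.map_map (by fun_prop) (by fun_prop)]
    rfl
  have : IsProbabilityMeasure ((jointLaw Q N π).map (fun ω => ω.1.1)) :=
    Measure.isProbabilityMeasure_map (by fun_prop)
  rw [h, map_input_noise_jointLaw]
  exact Measure.snd_prod

theorem indepFun_input_noise :
    IndepFun (fun ω : Outcome => ω.1.1) (y1 - x1) (jointLaw Q N π) := by
  rw [indepFun_iff_map_prod_eq_prod_map_map (by fun_prop) (by fun_prop), map_noise_jointLaw]
  exact map_input_noise_jointLaw Q N π

/-- `W₂` is drawn from a kernel that depends on `(X₀, W₁)` only, also given `U₁`. -/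
theorem map_X0_W1_U1_W2_jointLaw (Q N : ℝ) (π : Policy) :
    (jointLaw Q N π).map (fun ω => ((ω.1.1.1, ω.1.1.2.2), w2 ω)) =
      (((gaussianReal 0 Q.toNNReal).prod π.lawW1).compProd π.kerU1).compProd
        (π.kerW2.comap (fun p : (ℝ × ℝ) × ℝ => p.1) measurable_fst) := by
  have h : (jointLaw Q N π).map (fun ω => ((ω.1.1.1, ω.1.1.2.2), w2 ω))
      = ((jointLaw Q N π).map (fun ω => ω.1.1)).map (fun p => ((p.1, p.2.2), p.2.1)) := by
    rw [Measure.map_map (by fun_prop) (by fun_prop)]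
    rfl
  rw [h, map_input_jointLaw]
  refine Measure.ext_of_lintegral _ fun f hf => ?_
  rw [lintegral_map hf (by fun_prop), Measure.lintegral_compProd (by fun_prop),
    Measure.lintegral_compProd hf, Measure.lintegral_compProd
      (hf.lintegral_kernel_prod_right' (κ := π.kerW2.comap _ measurable_fst))]
  refine lintegral_congr fun a => ?_
  rw [Kernel.prod_apply, lintegral_prod_symm _ (by fun_prop)]
  rfl

theorem map_U2_jointLaw (Q N : ℝ) (π : Policy) :
    (jointLaw Q N π).map (fun ω => (ω.1, u2 ω)) =
      ((jointLaw Q N π).map (fun ω => ω.1)).compProd (π.kerU2.comap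
        (fun p : ((ℝ × ℝ) × (ℝ × ℝ)) × (ℝ × ℝ) => (p.1.1.2, p.1.2.1, p.2.2)) (by fun_prop)) := by
  have h : (jointLaw Q N π).map (fun ω => ω.1) = _ := Measure.fst_compProd _ _
  rw [h]
  exact Measure.map_id

section Gaussian

variable [IsGaussian (jointLaw Q N π)]

local notation "C" => covarianceBilinDual (jointLaw Q N π)

theorem cov_X0_X0 (hQ : 0 < Q) : C x0 x0 = Q := by
  rw [covarianceBilinDual_self_eq_var, ← Function.id_comp x0, ← variance_map (by fun_prop)
    (by fun_prop), map_X0_jointLaw, variance_id_gaussianReal]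
  simp [hQ.le]

theorem cov_noise_noise (hN : 0 < N) : C (y1 - x1) (y1 - x1) = N := by
  rw [covarianceBilinDual_self_eq_var, ← Function.id_comp (y1 - x1 : StrongDual ℝ Outcome),
    ← variance_map (by fun_prop) (by fun_prop), map_noise_jointLaw, variance_id_gaussianReal]
  simp [hN.le]

theorem cov_W1_X0 : C w1 x0 = 0 := by
  rw [covarianceBilinDual_eq_cov]
  exact indepFun_W1_X0.covariance_eq_zero (memLp_two_functional _) (memLp_two_functional _)

theorem cov_noise_input {L : StrongDual ℝ Outcome} {L' : (ℝ × ℝ) × (ℝ × ℝ) → ℝ}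
    (hL' : Measurable L') (hL : ∀ ω, L ω = L' ω.1.1) : C (y1 - x1) L = 0 := by
  rw [covarianceBilinDual_comm, covarianceBilinDual_eq_cov]
  refine IndepFun.covariance_eq_zero ?_ (memLp_two_functional _) (memLp_two_functional _)
  have h := (indepFun_input_noise (Q := Q) (N := N) (π := π)).comp hL' measurable_id
  rw [show (L : Outcome → ℝ) = L' ∘ fun ω => ω.1.1 from funext hL]
  exact h

theorem cov_noise_X0 : C (y1 - x1) x0 = 0 :=
  cov_noise_input (L' := fun p => p.1.1) (by fun_prop) fun _ => rfl

theorem cov_noise_W1 : C (y1 - x1) w1 = 0 :=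
  cov_noise_input (L' := fun p => p.1.2) (by fun_prop) fun _ => rfl

theorem cov_noise_W2 : C (y1 - x1) w2 = 0 :=
  cov_noise_input (L' := fun p => p.2.1) (by fun_prop) fun _ => rfl

theorem cov_noise_U1 : C (y1 - x1) u1 = 0 :=
  cov_noise_input (L' := fun p => p.2.2) (by fun_prop) fun _ => rfl

/-- `X₁ = X₀ + U₁` holds only almost surely; the difference has zero variance and hence no
covariance with anything. -/
theorem cov_X1 (L : StrongDual ℝ Outcome) : C L x1 = C L x0 + C L u1 := by
  have h0 : C (x1 - (x0 + u1)) (x1 - (x0 + u1)) = 0 := by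
    rw [covarianceBilinDual_self_eq_var]
    have h : (x1 - (x0 + u1) : StrongDual ℝ Outcome) =ᵐ[jointLaw Q N π] fun _ => 0 := by
      filter_upwards [ae_X1_eq] with ω hω
      simp_all
    rw [variance_congr h]
    exact variance_zero _
  have h := covarianceBilinDual_eq_zero_of_self_eq_zero h0 L
  rw [map_sub, map_add] at h
  linarith

/-- `U₁` and `W₂` are conditionally independent given `(X₀, W₁)`. -/
theorem cov_W2_eq_zero {a b : ℝ} (h0 : C (u1 - a • x0 - b • w1) x0 = 0)
    (h1 : C (u1 - a • x0 - b • w1) w1 = 0) : C (u1 - a • x0 - b • w1) w2 = 0 := by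
  rw [covarianceBilinDual_eq_cov]
  exact covariance_eq_zero_of_map_eq_compProd (μ := jointLaw Q N π)
    (X := fun ω => (ω.1.1.1, ω.1.1.2.2)) (U := w2) (by fun_prop) (by fun_prop) measurable_fst
    (map_X0_W1_U1_W2_jointLaw Q N π) (R := fun p => p.2 - a * p.1.1 - b * p.1.2) (by fun_prop)
    (indepFun_pair_of_covarianceBilinDual_eq_zero h0 h1)
    (memLp_two_functional (u1 - a • x0 - b • w1)) (memLp_two_functional _)

/-- `U₂` is conditionally independent of everything else given `(W₁, W₂, Y₁)`. -/
theorem cov_U2_eq_zero {r : StrongDual ℝ (((ℝ × ℝ) × (ℝ × ℝ)) × (ℝ × ℝ))}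
    (h1 : C (r ∘L .fst ℝ (((ℝ × ℝ) × (ℝ × ℝ)) × (ℝ × ℝ)) ℝ) w1 = 0)
    (h2 : C (r ∘L .fst ℝ (((ℝ × ℝ) × (ℝ × ℝ)) × (ℝ × ℝ)) ℝ) w2 = 0)
    (h3 : C (r ∘L .fst ℝ (((ℝ × ℝ) × (ℝ × ℝ)) × (ℝ × ℝ)) ℝ) y1 = 0) :
    C (r ∘L .fst ℝ (((ℝ × ℝ) × (ℝ × ℝ)) × (ℝ × ℝ)) ℝ) u2 = 0 := by
  have : IsProbabilityMeasure ((jointLaw Q N π).map (fun ω => ω.1)) :=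
    Measure.isProbabilityMeasure_map (by fun_prop)
  rw [covarianceBilinDual_eq_cov]
  exact covariance_eq_zero_of_map_eq_compProd (μ := jointLaw Q N π)
    (X := fun ω => ω.1) (U := u2) (by fun_prop) (by fun_prop) (by fun_prop)
    (map_U2_jointLaw Q N π) (R := r) (by fun_prop)
    (indepFun_triple_of_covarianceBilinDual_eq_zero h1 h2 h3)
    (memLp_two_functional (r ∘L .fst ℝ (((ℝ × ℝ) × (ℝ × ℝ)) × (ℝ × ℝ)) ℝ))
    (memLp_two_functional _)

end Gaussian

end JointLaw

end Witsenhausen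

/-! ### Converse: every Gaussian policy costs at least the closed form -/

namespace Witsenhausen

section Converse

variable {Q N : ℝ} {π : Policy}

/-- The constraint now compares what the one pair `(W₁, W₂)` tells about `Y₁` and about `X₀`, so one
residual formula serves both terms. -/
theorem condMutualInformation_jointLaw (Q N : ℝ) (π : Policy) :
    condMutualInformation (jointLaw Q N π) Outcome.W2 Outcome.X0 Outcome.W1
      = mutualInformation (jointLaw Q N π) (fun ω => (w1 ω, w2 ω)) x0 :=
  condMutualInformation_eq_mutualInformation_of_indepFun _ Outcome.measurable_X0
    Outcome.measurable_W2 Outcome.measurable_W1 indepFun_W1_X0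

variable [IsGaussian (jointLaw Q N π)]

local notation "C" => covarianceBilinDual (jointLaw Q N π)

/-- The second-order structure of a Gaussian policy: `U₁ = a X₀ + b W₁ + V`, and
`X₀ = c₁ W₁ + c₂ W₂ + R` with `V` and `R` uncorrelated with the regressors. -/
structure IsRegression (Q N : ℝ) (π : Policy) (a b c₁ c₂ : ℝ) : Prop where
  orth_V_X0 : covarianceBilinDual (jointLaw Q N π) (u1 - a • x0 - b • w1) x0 = 0
  orth_V_W1 : covarianceBilinDual (jointLaw Q N π) (u1 - a • x0 - b • w1) w1 = 0
  orth_R_W1 : covarianceBilinDual (jointLaw Q N π) (x0 - c₁ • w1 - c₂ • w2) w1 = 0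
  orth_R_W2 : covarianceBilinDual (jointLaw Q N π) (x0 - c₁ • w1 - c₂ • w2) w2 = 0

omit [IsGaussian (jointLaw Q N π)] in
theorem exists_isRegression (Q N : ℝ) (π : Policy) :
    ∃ a b c₁ c₂, IsRegression Q N π a b c₁ c₂ := by
  obtain ⟨a, b, h1, h2⟩ :=
    exists_covarianceBilinDual_sub_smul_sub_smul (jointLaw Q N π) u1 x0 w1
  obtain ⟨c₁, c₂, h3, h4⟩ :=
    exists_covarianceBilinDual_sub_smul_sub_smul (jointLaw Q N π) x0 w1 w2
  exact ⟨a, b, c₁, c₂, h1, h2, h3, h4⟩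

namespace IsRegression

variable {a b c₁ c₂ : ℝ}

theorem cov_R_V (h : IsRegression Q N π a b c₁ c₂) :
    C (x0 - c₁ • w1 - c₂ • w2) (u1 - a • x0 - b • w1) = 0 := by
  rw [covarianceBilinDual_comm, covarianceBilinDual_sub_smul_sub_smul, h.orth_V_X0, h.orth_V_W1,
    cov_W2_eq_zero h.orth_V_X0 h.orth_V_W1]
  ring

theorem cov_noise_V : C (y1 - x1) (u1 - a • x0 - b • w1) = 0 := by
  rw [covarianceBilinDual_sub_smul_sub_smul, cov_noise_U1, cov_noise_X0, cov_noise_W1]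
  ring

theorem cov_noise_R : C (y1 - x1) (x0 - c₁ • w1 - c₂ • w2) = 0 := by
  rw [covarianceBilinDual_sub_smul_sub_smul, cov_noise_X0, cov_noise_W1, cov_noise_W2]
  ring

omit [IsGaussian (jointLaw Q N π)] in
theorem cov_R_X0 (h : IsRegression Q N π a b c₁ c₂) :
    C (x0 - c₁ • w1 - c₂ • w2) x0
      = C (x0 - c₁ • w1 - c₂ • w2) (x0 - c₁ • w1 - c₂ • w2) := by
  rw [covarianceBilinDual_sub_smul_sub_smul _ _ x0, h.orth_R_W1, h.orth_R_W2]
  ring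

/-- `Var (X₀ - R) = Q - Var R`, because `R` has covariance `Var R` with `X₀`. -/
theorem residual_le (h : IsRegression Q N π a b c₁ c₂) (hQ : 0 < Q) :
    C (x0 - c₁ • w1 - c₂ • w2) (x0 - c₁ • w1 - c₂ • w2) ≤ Q := by
  set R := x0 - c₁ • w1 - c₂ • w2 with hR
  have h1 : 0 ≤ C (x0 - R) (x0 - R) := covarianceBilinDual_self_nonneg _
  have h2 := h.cov_R_X0
  have h3 : C x0 R = C R x0 := covarianceBilinDual_comm _ _
  have h4 := cov_X0_X0 (N := N) (π := π) hQ
  simp only [map_sub, sub_apply] at h1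
  rw [← hR] at h2
  linarith

/-- Almost surely `X₁ = (a + 1) X₀ + b W₁ + V`; inserting the regression of `X₀` leaves `(a + 1) R +
V`. -/
theorem cov_X1_residual (L : StrongDual ℝ Outcome) :
    C (x1 - ((a + 1) * c₁ + b) • w1 - ((a + 1) * c₂) • w2) L
      = (a + 1) * C (x0 - c₁ • w1 - c₂ • w2) L + C (u1 - a • x0 - b • w1) L := by
  have h1 : C x1 L = C x0 L + C u1 L := by
    rw [covarianceBilinDual_comm, cov_X1, covarianceBilinDual_comm x0, covarianceBilinDual_comm u1]
  simp only [map_sub, map_smul, sub_apply, smul_apply, h1, smul_eq_mul]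
  ring

theorem cov_Y1_residual (L : StrongDual ℝ Outcome) :
    C (y1 - ((a + 1) * c₁ + b) • w1 - ((a + 1) * c₂) • w2) L
      = (a + 1) * C (x0 - c₁ • w1 - c₂ • w2) L + C (u1 - a • x0 - b • w1) L
        + C (y1 - x1) L := by
  rw [← cov_X1_residual]
  simp only [map_sub, map_smul, sub_apply, smul_apply]
  ring

theorem cov_Y1 (L : StrongDual ℝ Outcome) :
    C y1 L = (a + 1) * C x0 L + b * C w1 L + C (u1 - a • x0 - b • w1) L + C (y1 - x1) L := by
  have h1 : C x1 L = C x0 L + C u1 L := by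
    rw [covarianceBilinDual_comm, cov_X1, covarianceBilinDual_comm x0, covarianceBilinDual_comm u1]
  simp only [map_sub, map_smul, sub_apply, smul_apply, h1, smul_eq_mul]
  ring

theorem cov_Y1_residual_W1 (h : IsRegression Q N π a b c₁ c₂) :
    C (y1 - ((a + 1) * c₁ + b) • w1 - ((a + 1) * c₂) • w2) w1 = 0 := by
  rw [cov_Y1_residual, h.orth_R_W1, h.orth_V_W1, cov_noise_W1]
  ring

/-- The Markov chain `U₁ - (X₀, W₁) - W₂` enters here: without it, `V` could correlate with `W₂`. -/
theorem cov_Y1_residual_W2 (h : IsRegression Q N π a b c₁ c₂) :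
    C (y1 - ((a + 1) * c₁ + b) • w1 - ((a + 1) * c₂) • w2) w2 = 0 := by
  rw [cov_Y1_residual, h.orth_R_W2, cov_W2_eq_zero h.orth_V_X0 h.orth_V_W1, cov_noise_W2]
  ring

theorem cov_Y1_residual_self (h : IsRegression Q N π a b c₁ c₂) (hN : 0 < N) :
    C (y1 - ((a + 1) * c₁ + b) • w1 - ((a + 1) * c₂) • w2)
      (y1 - ((a + 1) * c₁ + b) • w1 - ((a + 1) * c₂) • w2)
      = (a + 1) ^ 2 * C (x0 - c₁ • w1 - c₂ • w2) (x0 - c₁ • w1 - c₂ • w2)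
        + C (u1 - a • x0 - b • w1) (u1 - a • x0 - b • w1) + N := by
  rw [cov_Y1_residual, covarianceBilinDual_comm (x0 - c₁ • w1 - c₂ • w2),
    covarianceBilinDual_comm (u1 - a • x0 - b • w1), covarianceBilinDual_comm (y1 - x1),
    cov_Y1_residual, cov_Y1_residual, cov_Y1_residual, h.cov_R_V,
    covarianceBilinDual_comm (u1 - a • x0 - b • w1) (x0 - c₁ • w1 - c₂ • w2), h.cov_R_V,
    covarianceBilinDual_comm _ (y1 - x1), covarianceBilinDual_comm _ (y1 - x1), cov_noise_V,
    cov_noise_R, cov_noise_noise hN]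
  ring

theorem cov_Y1_self (h : IsRegression Q N π a b c₁ c₂) (hQ : 0 < Q) (hN : 0 < N) :
    C y1 y1 = (a + 1) ^ 2 * Q + b ^ 2 * C w1 w1
        + C (u1 - a • x0 - b • w1) (u1 - a • x0 - b • w1) + N := by
  have e1 : C x0 (u1 - a • x0 - b • w1) = 0 := by rw [covarianceBilinDual_comm, h.orth_V_X0]
  have e2 : C w1 (u1 - a • x0 - b • w1) = 0 := by rw [covarianceBilinDual_comm, h.orth_V_W1]
  have e3 : C x0 (y1 - x1) = 0 := by rw [covarianceBilinDual_comm, cov_noise_X0]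
  have e4 : C w1 (y1 - x1) = 0 := by rw [covarianceBilinDual_comm, cov_noise_W1]
  have e5 : C (u1 - a • x0 - b • w1) (y1 - x1) = 0 := by
    rw [covarianceBilinDual_comm, cov_noise_V]
  have e6 : C x0 w1 = 0 := by rw [covarianceBilinDual_comm, cov_W1_X0]
  rw [cov_Y1 (a := a) (b := b), covarianceBilinDual_comm x0 y1, covarianceBilinDual_comm w1 y1,
    covarianceBilinDual_comm _ y1, covarianceBilinDual_comm _ y1,
    cov_Y1 (a := a) (b := b) x0, cov_Y1 (a := a) (b := b) w1,
    cov_Y1 (a := a) (b := b) (u1 - a • x0 - b • w1), cov_Y1 (a := a) (b := b) (y1 - x1),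
    e1, e2, e3, e4, e5, e6, cov_W1_X0, h.orth_V_X0, h.orth_V_W1, cov_noise_X0, cov_noise_W1,
    cov_noise_V, cov_noise_noise hN, cov_X0_X0 hQ]
  ring

theorem cov_U1_self (h : IsRegression Q N π a b c₁ c₂) (hQ : 0 < Q) :
    C u1 u1 = a ^ 2 * Q + b ^ 2 * C w1 w1
        + C (u1 - a • x0 - b • w1) (u1 - a • x0 - b • w1) := by
  have h1 := h.orth_V_X0
  have h2 := h.orth_V_W1
  have e6 : C x0 w1 = 0 := by rw [covarianceBilinDual_comm, cov_W1_X0]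
  have e7 : C u1 x0 = C x0 u1 := covarianceBilinDual_comm _ _
  have e8 : C u1 w1 = C w1 u1 := covarianceBilinDual_comm _ _
  simp only [map_sub, map_smul, sub_apply, smul_apply, smul_eq_mul, cov_X0_X0 hQ, cov_W1_X0, e6,
    ← e7, ← e8] at h1 h2 ⊢
  linear_combination (2 * a) * h1 + (2 * b) * h2

theorem mutualInformation_output (h : IsRegression Q N π a b c₁ c₂) (hQ : 0 < Q) (hN : 0 < N) :
    mutualInformation (jointLaw Q N π) (fun ω => (ω.W1, ω.W2)) Outcome.Y1 =
      ENNReal.ofReal (Real.log (((a + 1) ^ 2 * Q + b ^ 2 * C w1 w1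
        + C (u1 - a • x0 - b • w1) (u1 - a • x0 - b • w1) + N) /
        ((a + 1) ^ 2 * C (x0 - c₁ • w1 - c₂ • w2) (x0 - c₁ • w1 - c₂ • w2)
        + C (u1 - a • x0 - b • w1) (u1 - a • x0 - b • w1) + N)) / 2) := by
  have h1 : 0 ≤ C (u1 - a • x0 - b • w1) (u1 - a • x0 - b • w1) :=
    covarianceBilinDual_self_nonneg _
  have h2 : 0 ≤ C (x0 - c₁ • w1 - c₂ • w2) (x0 - c₁ • w1 - c₂ • w2) :=
    covarianceBilinDual_self_nonneg _
  have h3 : 0 ≤ C w1 w1 := covarianceBilinDual_self_nonneg _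
  rw [← h.cov_Y1_residual_self hN, ← h.cov_Y1_self hQ hN]
  refine mutualInformation_functional h.cov_Y1_residual_W1 h.cov_Y1_residual_W2 ?_ ?_
  · rw [h.cov_Y1_residual_self hN]
    positivity
  · rw [h.cov_Y1_self hQ hN]
    positivity

theorem mutualInformation_state (h : IsRegression Q N π a b c₁ c₂) (hQ : 0 < Q)
    (hT : 0 < C (x0 - c₁ • w1 - c₂ • w2) (x0 - c₁ • w1 - c₂ • w2)) :
    condMutualInformation (jointLaw Q N π) Outcome.W2 Outcome.X0 Outcome.W1 =
      ENNReal.ofReal (Real.log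
        (Q / C (x0 - c₁ • w1 - c₂ • w2) (x0 - c₁ • w1 - c₂ • w2)) / 2) := by
  rw [condMutualInformation_jointLaw,
    mutualInformation_functional h.orth_R_W1 h.orth_R_W2 hT (by rwa [cov_X0_X0 hQ]), cov_X0_X0 hQ]

theorem mutualInformation_state_eq_top (hQ : 0 < Q)
    (hT : C (x0 - c₁ • w1 - c₂ • w2) (x0 - c₁ • w1 - c₂ • w2) = 0) :
    condMutualInformation (jointLaw Q N π) Outcome.W2 Outcome.X0 Outcome.W1 = ∞ := by
  rw [condMutualInformation_jointLaw]
  exact mutualInformation_functional_eq_top hT (by rwa [cov_X0_X0 hQ])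

/-- The information constraint in terms of the second moments. -/
theorem information_constraint (h : IsRegression Q N π a b c₁ c₂) (hQ : 0 < Q) (hN : 0 < N)
    (hI : 0 ≤ (mutualInformation (jointLaw Q N π) (fun ω => (ω.W1, ω.W2)) Outcome.Y1 : EReal)
      - (condMutualInformation (jointLaw Q N π) Outcome.W2 Outcome.X0 Outcome.W1 : EReal)) :
    0 < C (x0 - c₁ • w1 - c₂ • w2) (x0 - c₁ • w1 - c₂ • w2) ∧
      Q * ((a + 1) ^ 2 * C (x0 - c₁ • w1 - c₂ • w2) (x0 - c₁ • w1 - c₂ • w2)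
        + C (u1 - a • x0 - b • w1) (u1 - a • x0 - b • w1) + N) ≤
      C (x0 - c₁ • w1 - c₂ • w2) (x0 - c₁ • w1 - c₂ • w2) * ((a + 1) ^ 2 * Q + b ^ 2 * C w1 w1
        + C (u1 - a • x0 - b • w1) (u1 - a • x0 - b • w1) + N) := by
  have hv : 0 ≤ C (u1 - a • x0 - b • w1) (u1 - a • x0 - b • w1) :=
    covarianceBilinDual_self_nonneg _
  have hT : 0 ≤ C (x0 - c₁ • w1 - c₂ • w2) (x0 - c₁ • w1 - c₂ • w2) :=
    covarianceBilinDual_self_nonneg _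
  have hs : 0 ≤ C w1 w1 := covarianceBilinDual_self_nonneg _
  rw [h.mutualInformation_output hQ hN] at hI
  rcases hT.eq_or_lt with hT0 | hT0
  -- If `T = 0`, the subtracted information is infinite while the first is finite, as the noise is
  -- nondegenerate.
  · rw [mutualInformation_state_eq_top hQ hT0.symm] at hI
    simp at hI
  rw [h.mutualInformation_state hQ hT0] at hI
  refine ⟨hT0, ?_⟩
  have hle := h.residual_le hQ
  set T := C (x0 - c₁ • w1 - c₂ • w2) (x0 - c₁ • w1 - c₂ • w2)
  set v := C (u1 - a • x0 - b • w1) (u1 - a • x0 - b • w1)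
  rw [EReal.sub_nonneg (by simp) (by simp), EReal.coe_ennreal_le_coe_ennreal_iff] at hI
  -- `ENNReal.ofReal` truncates at `0`, so the logarithms can be compared only when the one for `X₀`
  -- is positive, i.e. `T < Q`. For `T = Q` the inequality is immediate.
  rcases hle.eq_or_lt with hTQ | hTQ
  · rw [hTQ]
    gcongr
    nlinarith [mul_nonneg (sq_nonneg b) hs]
  · have h1 : 0 < Real.log (Q / T) / 2 :=
      half_pos (Real.log_pos ((one_lt_div hT0).2 hTQ))
    have h2 := (ENNReal.ofReal_le_ofReal_iff' .. |>.1 hI).resolve_right (not_le.2 h1)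
    have h3 : Real.log (Q / T) ≤ Real.log (((a + 1) ^ 2 * Q + b ^ 2 * C w1 w1 + v + N) /
      ((a + 1) ^ 2 * T + v + N)) := by linarith
    rw [Real.log_le_log_iff (by positivity) (by positivity),
      div_le_div_iff₀ hT0 (by positivity)] at h3
    linarith

/-- The cost is at least the minimum mean square error. -/
theorem mmse_le_cov (h : IsRegression Q N π a b c₁ c₂) (hN : 0 < N) {D : ℝ}
    (hD : D = (a + 1) ^ 2 * C (x0 - c₁ • w1 - c₂ • w2) (x0 - c₁ • w1 - c₂ • w2)
        + C (u1 - a • x0 - b • w1) (u1 - a • x0 - b • w1)) :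
    D * N / (D + N) ≤ C (x1 - u2) (x1 - u2) := by
  have hv : 0 ≤ C (u1 - a • x0 - b • w1) (u1 - a • x0 - b • w1) :=
    covarianceBilinDual_self_nonneg _
  have hT : 0 ≤ C (x0 - c₁ • w1 - c₂ • w2) (x0 - c₁ • w1 - c₂ • w2) :=
    covarianceBilinDual_self_nonneg _
  have hD0 : 0 ≤ D := by rw [hD]; positivity
  set k := D / (D + N) with hk
  set p := (a + 1) * c₁ + b with hp
  set q := (a + 1) * c₂ with hq
  -- The error of the optimal linear estimate of `X₁` from `(W₁, W₂, Y₁)`, with Wiener gain `k`. It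
  -- is orthogonal to the observations, hence by the Markov property to `U₂`, so `Var (X₁ - U₂) =
  -- Var S + Var (X₁ - U₂ - S)`.
  set S : StrongDual ℝ Outcome := (x1 - p • w1 - q • w2) - k • (y1 - p • w1 - q • w2) with hS
  have cS : ∀ L, C S L = (1 - k) * ((a + 1) * C (x0 - c₁ • w1 - c₂ • w2) L
      + C (u1 - a • x0 - b • w1) L) - k * C (y1 - x1) L := by
    intro L
    rw [hS, map_sub (covarianceBilinDual _) _ (k • _), map_smul, sub_apply, smul_apply, hp, hq,
      cov_X1_residual, cov_Y1_residual, smul_eq_mul]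
    ring
  have s1 : C S w1 = 0 := by
    rw [cS, h.orth_R_W1, h.orth_V_W1, cov_noise_W1]
    ring
  have s2 : C S w2 = 0 := by
    rw [cS, h.orth_R_W2, cov_W2_eq_zero h.orth_V_X0 h.orth_V_W1, cov_noise_W2]
    ring
  have r1 : C (x0 - c₁ • w1 - c₂ • w2) (y1 - p • w1 - q • w2)
      = (a + 1) * C (x0 - c₁ • w1 - c₂ • w2) (x0 - c₁ • w1 - c₂ • w2) := by
    rw [covarianceBilinDual_comm, cov_Y1_residual, covarianceBilinDual_comm (u1 - a • x0 - b • w1),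
      h.cov_R_V, cov_noise_R]
    ring
  have r2 : C (u1 - a • x0 - b • w1) (y1 - p • w1 - q • w2)
      = C (u1 - a • x0 - b • w1) (u1 - a • x0 - b • w1) := by
    rw [covarianceBilinDual_comm, cov_Y1_residual, h.cov_R_V, cov_noise_V]
    ring
  have r3 : C (y1 - x1) (y1 - p • w1 - q • w2) = N := by
    rw [covarianceBilinDual_comm, cov_Y1_residual, covarianceBilinDual_comm _ (y1 - x1),
      covarianceBilinDual_comm _ (y1 - x1), cov_noise_V, cov_noise_R, cov_noise_noise hN]
    ring
  have s3' : C S (y1 - p • w1 - q • w2) = 0 := by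
    rw [cS, r1, r2, r3, hk]
    rw [← sub_eq_zero] at hD
    field_simp
    linear_combination (-N) * hD
  have s3 : C S y1 = 0 := by
    rw [covarianceBilinDual_sub_smul_sub_smul, s1, s2] at s3'
    simpa using s3'
  have s4 : C S u2 = 0 := by
    let r : StrongDual ℝ (((ℝ × ℝ) × (ℝ × ℝ)) × (ℝ × ℝ)) :=
      S ∘L .inl ℝ (((ℝ × ℝ) × (ℝ × ℝ)) × (ℝ × ℝ)) ℝ
    have e : S = r ∘L .fst ℝ (((ℝ × ℝ) × (ℝ × ℝ)) × (ℝ × ℝ)) ℝ := by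
      ext <;> simp [r, hS]
    rw [e] at s1 s2 s3 ⊢
    exact cov_U2_eq_zero s1 s2 s3
  have e : C S x1 = C S S := by
    have : C S S = C S ((x1 - p • w1 - q • w2) - k • (y1 - p • w1 - q • w2)) := rfl
    rw [this, map_sub (C S) _ (k • _), map_smul, s3', covarianceBilinDual_sub_smul_sub_smul, s1, s2]
    simp
  have s5 : C S S = D * N / (D + N) := by
    -- Computing the covariance of `S` with the noise in two ways yields `Var S = k N`.
    have e2 : C S (y1 - x1) = - C S S := by rw [map_sub, s3, e, zero_sub]
    have e3 : C S (y1 - x1) = -(k * N) := by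
      rw [cS, covarianceBilinDual_comm _ (y1 - x1), covarianceBilinDual_comm _ (y1 - x1),
        cov_noise_R, cov_noise_V, cov_noise_noise hN]
      ring
    have : C S S = k * N := by linarith
    rw [this, hk]
    ring
  have h0 : 0 ≤ C (x1 - u2 - S) (x1 - u2 - S) := covarianceBilinDual_self_nonneg _
  rw [map_sub (C (x1 - u2 - S)), map_sub (covarianceBilinDual _) _ S, sub_apply, sub_apply,
    covarianceBilinDual_comm _ S, map_sub (C S), e, s4] at h0
  rw [← s5]
  linarith

end IsRegression

/-- Nonzero means can only add to the power and to the cost. -/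
theorem cov_le_integral_sq (L : StrongDual ℝ Outcome) :
    C L L ≤ ∫ ω, L ω ^ 2 ∂(jointLaw Q N π) := by
  rw [covarianceBilinDual_self_eq_var]
  exact variance_le_expectation_sq (by fun_prop)

end Converse

/-- The converse: no Gaussian policy beats the closed form. -/
theorem gaussianCostFormula_le_estimationCost {Q N P : ℝ} (hQ : 0 < Q) (hN : 0 < N) {π : Policy}
    (hπ : π ∈ gaussianPolicies Q N P) : gaussianCostFormula Q N P ≤ estimationCost Q N π := by
  obtain ⟨hP, hI, hG⟩ := hπ
  obtain ⟨a, b, c₁, c₂, h⟩ := exists_isRegression Q N π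
  obtain ⟨hT, hc⟩ := h.information_constraint hQ hN hI
  have hv : 0 ≤ covarianceBilinDual (jointLaw Q N π) (u1 - a • x0 - b • w1)
    (u1 - a • x0 - b • w1) := covarianceBilinDual_self_nonneg _
  have hs : 0 ≤ covarianceBilinDual (jointLaw Q N π) w1 w1 := covarianceBilinDual_self_nonneg _
  have hpow := cov_le_integral_sq (Q := Q) (N := N) (π := π) u1
  rw [h.cov_U1_self hQ] at hpow
  have hP' : ((a + 1) - 1) ^ 2 * Q + b ^ 2 * covarianceBilinDual (jointLaw Q N π) w1 w1
      + covarianceBilinDual (jointLaw Q N π) (u1 - a • x0 - b • w1) (u1 - a • x0 - b • w1)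
      ≤ P := by
    rw [hP, add_sub_cancel_right]
    exact hpow
  have hβ := mul_nonneg (sq_nonneg b) hs
  have h1 := slopeCost_le_of_constraint hQ hN hβ hv hT hP' hc
  have h2 := h.mmse_le_cov hN rfl
  have h3 := cov_le_integral_sq (Q := Q) (N := N) (π := π) (x1 - u2)
  refine (gaussianCostFormula_le_slopeCost hQ hN ?_).trans (h1.trans (h2.trans h3))
  have e : (√Q - √Q * (a + 1)) ^ 2 = ((a + 1) - 1) ^ 2 * Q := by
    linear_combination a ^ 2 * Real.sq_sqrt hQ.le
  rw [e]
  linarith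

end Witsenhausen

/-! ### Achievability by explicit linear policies -/

namespace Witsenhausen

/-- The policy `W₁ ∼ 𝒩(0, 1)`, `W₂ = c X₀ + V` with `V ∼ 𝒩(0, 1)`, `U₁ = a X₀ + b W₁` and
`U₂ = p W₁ + q W₂ + k (Y₁ - p W₁ - q W₂)`. -/
noncomputable def linearPolicy (a b c p q k : ℝ) : Policy where
  lawW1 := gaussianReal 0 1
  kerW2 := (Kernel.id.prod (Kernel.const (ℝ × ℝ) (gaussianReal 0 1))).map
    (fun t : (ℝ × ℝ) × ℝ => c * t.1.1 + t.2)
  kerU1 := Kernel.deterministic (fun t : ℝ × ℝ => a * t.1 + b * t.2) (by fun_prop)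
  kerU2 := Kernel.deterministic
    (fun t : ℝ × ℝ × ℝ => p * t.1 + q * t.2.1 + k * (t.2.2 - p * t.1 - q * t.2.1)) (by fun_prop)
  probW1 := inferInstance
  markovW2 := Kernel.IsMarkovKernel.map _ (by fun_prop)
  markovU1 := inferInstance
  markovU2 := inferInstance

/-- The outcome under `linearPolicy`, as a function of the primitive variables `X₀, W₁, V, Z₁`. -/
def linearOutcome (a b c p q k : ℝ) (t : (ℝ × ℝ) × (ℝ × ℝ)) : Outcome :=
  ((((t.1.1, t.1.2), (c * t.1.1 + t.2.1, a * t.1.1 + b * t.1.2)),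
    (t.1.1 + (a * t.1.1 + b * t.1.2), t.1.1 + (a * t.1.1 + b * t.1.2) + t.2.2)),
    p * t.1.2 + q * (c * t.1.1 + t.2.1) + k * (t.1.1 + (a * t.1.1 + b * t.1.2) + t.2.2
      - p * t.1.2 - q * (c * t.1.1 + t.2.1)))

/-- The law of the primitive variables. -/
noncomputable def primitiveLaw (Q N : ℝ) : Measure ((ℝ × ℝ) × (ℝ × ℝ)) :=
  ((gaussianReal 0 Q.toNNReal).prod (gaussianReal 0 1)).prod
    ((gaussianReal 0 1).prod (gaussianReal 0 N.toNNReal))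

instance (Q N : ℝ) : IsGaussian (primitiveLaw Q N) := by
  unfold primitiveLaw
  infer_instance

variable {Q N : ℝ} {a b c p q k : ℝ}

theorem measurable_linearOutcome : Measurable (linearOutcome a b c p q k) := by
  unfold linearOutcome
  fun_prop

theorem map_input_linearPolicy (Q : ℝ) (a b c p q k : ℝ) :
    ((gaussianReal 0 Q.toNNReal).prod (linearPolicy a b c p q k).lawW1).compProd
        ((linearPolicy a b c p q k).kerW2.prod (linearPolicy a b c p q k).kerU1)
      = (((gaussianReal 0 Q.toNNReal).prod (gaussianReal 0 1)).prod (gaussianReal 0 1)).map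
        (fun t => (t.1, (c * t.1.1 + t.2, a * t.1.1 + b * t.1.2))) := by
  refine Measure.ext_of_lintegral _ fun f hf => ?_
  rw [lintegral_map hf (by fun_prop), Measure.lintegral_compProd hf,
    lintegral_prod (fun t : (ℝ × ℝ) × ℝ => f (t.1, (c * t.1.1 + t.2, a * t.1.1 + b * t.1.2)))
      (by fun_prop)]
  refine lintegral_congr fun s => ?_
  have h1 : (linearPolicy a b c p q k).kerW2 s
      = (gaussianReal 0 1).map (fun v => c * s.1 + v) := by
    refine Measure.ext_of_lintegral _ fun g hg => ?_
    simp only [linearPolicy]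
    rw [Kernel.map_apply _ (by fun_prop), lintegral_map hg (by fun_prop), Kernel.prod_apply,
      lintegral_prod _ (by fun_prop), Kernel.id_apply, lintegral_dirac' _ (by fun_prop),
      Kernel.const_apply, lintegral_map hg (by fun_prop)]
  have h2 : (linearPolicy a b c p q k).kerU1 s = Measure.dirac (a * s.1 + b * s.2) := rfl
  rw [Kernel.prod_apply, h1, h2, lintegral_prod _ (by fun_prop),
    lintegral_map (by fun_prop) (by fun_prop)]
  refine lintegral_congr fun v => ?_
  rw [lintegral_dirac' _ (by fun_prop)]

theorem jointLaw_linearPolicy (Q N a b c p q k : ℝ) :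
    jointLaw Q N (linearPolicy a b c p q k)
      = (primitiveLaw Q N).map (linearOutcome a b c p q k) := by
  have h := map_U2_jointLaw Q N (linearPolicy a b c p q k)
  rw [show (fun ω : Outcome => (ω.1, u2 ω)) = id from rfl, Measure.map_id, map_fst_jointLaw,
    map_input_linearPolicy] at h
  have hd : (linearPolicy a b c p q k).kerU2.comap
      (fun t : ((ℝ × ℝ) × (ℝ × ℝ)) × (ℝ × ℝ) => (t.1.1.2, t.1.2.1, t.2.2)) (by fun_prop)
      = Kernel.deterministic (fun t : ((ℝ × ℝ) × (ℝ × ℝ)) × (ℝ × ℝ) => p * t.1.1.2 + q * t.1.2.1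
        + k * (t.2.2 - p * t.1.1.2 - q * t.1.2.1)) (by fun_prop) := rfl
  have hm : Measurable fun t : ((ℝ × ℝ) × ℝ) => (t.1, (c * t.1.1 + t.2, a * t.1.1 + b * t.1.2)) := by
    fun_prop
  have hN : gaussianReal 0 N.toNNReal = (gaussianReal 0 N.toNNReal).map id := Measure.map_id.symm
  rw [hd, Measure.compProd_deterministic, hN, Measure.map_prod_map _ _ hm measurable_id,
    Measure.map_map (by fun_prop) (by fun_prop), Measure.map_map (by fun_prop) (by fun_prop)] at h
  rw [h, primitiveLaw, ← Measure.prodAssoc_prod,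
    Measure.map_map measurable_linearOutcome (by fun_prop)]
  rfl

theorem isLinearMap_linearOutcome : IsLinearMap ℝ (linearOutcome a b c p q k) := by
  constructor
  · intro s t
    ext <;> simp only [linearOutcome, Prod.fst_add, Prod.snd_add] <;> ring
  · intro r t
    ext <;> simp only [linearOutcome, Prod.smul_fst, Prod.smul_snd, smul_eq_mul] <;> ring

instance : IsGaussian (jointLaw Q N (linearPolicy a b c p q k)) := by
  rw [jointLaw_linearPolicy]
  exact isGaussian_map (LinearMap.toContinuousLinearMap
    (isLinearMap_linearOutcome (a := a) (b := b) (c := c) (p := p) (q := q) (k := k)).mk')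

local notation "C" => covarianceBilinDual (jointLaw Q N (linearPolicy a b c p q k))

theorem ae_linearPolicy {f : Outcome → ℝ} (hf : Measurable f)
    (h : ∀ t, f (linearOutcome a b c p q k t) = 0) :
    ∀ᵐ ω ∂(jointLaw Q N (linearPolicy a b c p q k)), f ω = 0 := by
  rw [jointLaw_linearPolicy, ae_map_iff measurable_linearOutcome.aemeasurable
    (measurableSet_eq_fun hf measurable_const)]
  exact .of_forall h

theorem cov_eq_zero_linearPolicy {L : StrongDual ℝ Outcome}
    (h : ∀ t, L (linearOutcome a b c p q k t) = 0) (M : StrongDual ℝ Outcome) : C L M = 0 := by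
  rw [covarianceBilinDual_comm]
  refine covarianceBilinDual_eq_zero_of_self_eq_zero ?_ M
  rw [covarianceBilinDual_self_eq_var, variance_congr (ae_linearPolicy (f := L) (by fun_prop) h)]
  exact variance_zero _

theorem map_X0_W1_V_linearPolicy :
    (jointLaw Q N (linearPolicy a b c p q k)).map (fun ω => (ω.1.1.1, (w2 - c • x0) ω))
      = ((gaussianReal 0 Q.toNNReal).prod (gaussianReal 0 1)).prod (gaussianReal 0 1) := by
  rw [jointLaw_linearPolicy, Measure.map_map (by fun_prop) measurable_linearOutcome]
  have e : ((fun ω : Outcome => (ω.1.1.1, (w2 - c • x0) ω)) ∘ linearOutcome a b c p q k)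
      = Prod.map id Prod.fst := by
    ext t <;> simp [linearOutcome]
  rw [e, primitiveLaw, ← Measure.map_prod_map _ _ measurable_id measurable_fst, Measure.map_id,
    Measure.map_fst_prod]
  simp

theorem map_V_linearPolicy :
    (jointLaw Q N (linearPolicy a b c p q k)).map (w2 - c • x0) = gaussianReal 0 1 := by
  have h : (jointLaw Q N (linearPolicy a b c p q k)).map (w2 - c • x0)
      = ((jointLaw Q N (linearPolicy a b c p q k)).map
        (fun ω => (ω.1.1.1, (w2 - c • x0) ω))).map (fun t => t.2) := by
    rw [Measure.map_map (by fun_prop) (by fun_prop)]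
    rfl
  rw [h, map_X0_W1_V_linearPolicy]
  exact Measure.snd_prod

theorem indepFun_X0_W1_V_linearPolicy : IndepFun (fun ω : Outcome => ω.1.1.1) (w2 - c • x0)
    (jointLaw Q N (linearPolicy a b c p q k)) := by
  rw [indepFun_iff_map_prod_eq_prod_map_map (by fun_prop) (by fun_prop), map_V_linearPolicy,
    map_X0_W1_jointLaw]
  exact map_X0_W1_V_linearPolicy

theorem cov_V_X0_linearPolicy : C (w2 - c • x0) x0 = 0 := by
  rw [covarianceBilinDual_comm, covarianceBilinDual_eq_cov]
  exact (indepFun_X0_W1_V_linearPolicy.comp measurable_fst measurable_id).covariance_eq_zero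
    (memLp_two_functional x0) (memLp_two_functional _)

theorem cov_V_W1_linearPolicy : C (w2 - c • x0) w1 = 0 := by
  rw [covarianceBilinDual_comm, covarianceBilinDual_eq_cov]
  exact (indepFun_X0_W1_V_linearPolicy.comp measurable_snd measurable_id).covariance_eq_zero
    (memLp_two_functional w1) (memLp_two_functional _)

theorem cov_V_V_linearPolicy : C (w2 - c • x0) (w2 - c • x0) = 1 := by
  rw [covarianceBilinDual_self_eq_var, ← Function.id_comp (w2 - c • x0 : StrongDual ℝ Outcome),
    ← variance_map (by fun_prop) (by fun_prop), map_V_linearPolicy, variance_id_gaussianReal]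
  simp

theorem cov_W1_W1_linearPolicy : C w1 w1 = 1 := by
  rw [covarianceBilinDual_self_eq_var, ← Function.id_comp w1,
    ← variance_map (by fun_prop) (by fun_prop), map_W1_jointLaw, linearPolicy,
    variance_id_gaussianReal]
  simp

theorem measurePreserving_neg_primitiveLaw :
    MeasurePreserving (fun t => -t) (primitiveLaw Q N) (primitiveLaw Q N) := by
  have h : ∀ v, MeasurePreserving (fun x => -x) (gaussianReal 0 v) (gaussianReal 0 v) :=
    fun v => ⟨measurable_neg, by rw [gaussianReal_map_neg, neg_zero]⟩
  exact ((h _).prod (h _)).prod ((h _).prod (h _))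

/-- An odd function integrated against a law that is symmetric under negation. -/
theorem integral_functional_linearPolicy (L : StrongDual ℝ Outcome) :
    ∫ ω, L ω ∂(jointLaw Q N (linearPolicy a b c p q k)) = 0 := by
  have h0 : ∫ ω, L ω ∂(jointLaw Q N (linearPolicy a b c p q k))
      = ∫ t, L (linearOutcome a b c p q k t) ∂(primitiveLaw Q N) := by
    rw [jointLaw_linearPolicy, integral_map measurable_linearOutcome.aemeasurable (by fun_prop)]
  have h1 : ∫ t, L (linearOutcome a b c p q k t) ∂(primitiveLaw Q N)
      = ∫ t, L (linearOutcome a b c p q k (-t)) ∂(primitiveLaw Q N) := by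
    conv_lhs => rw [← (measurePreserving_neg_primitiveLaw (Q := Q) (N := N)).map_eq]
    rw [integral_map (by fun_prop)]
    exact (L.continuous.measurable.comp measurable_linearOutcome).aestronglyMeasurable
  have h2 : ∀ t, L (linearOutcome a b c p q k (-t)) = -L (linearOutcome a b c p q k t) := by
    intro t
    rw [← map_neg, ← isLinearMap_linearOutcome.map_neg]
  simp_rw [h2, integral_neg] at h1
  linarith

theorem integral_sq_linearPolicy (L : StrongDual ℝ Outcome) :
    ∫ ω, L ω ^ 2 ∂(jointLaw Q N (linearPolicy a b c p q k)) = C L L := by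
  rw [covarianceBilinDual_self_eq_var, variance_eq_sub (memLp_two_functional L),
    integral_functional_linearPolicy]
  simp

theorem isRegression_linearPolicy (hQ : 0 < Q) :
    IsRegression Q N (linearPolicy a b c p q k) a b 0 (c * Q / (c ^ 2 * Q + 1)) := by
  have hd : 0 < c ^ 2 * Q + 1 := by positivity
  have e1 := cov_V_X0_linearPolicy (Q := Q) (N := N) (a := a) (b := b) (c := c) (p := p) (q := q)
    (k := k)
  have e2 := cov_V_W1_linearPolicy (Q := Q) (N := N) (a := a) (b := b) (c := c) (p := p) (q := q)
    (k := k)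
  have e3 := cov_V_V_linearPolicy (Q := Q) (N := N) (a := a) (b := b) (c := c) (p := p) (q := q)
    (k := k)
  have e4 : C x0 w1 = 0 := by rw [covarianceBilinDual_comm, cov_W1_X0]
  have e5 : C x0 w2 = C w2 x0 := covarianceBilinDual_comm _ _
  simp only [map_sub, map_smul, sub_apply, smul_apply, smul_eq_mul, cov_X0_X0 hQ, e4, e5]
    at e1 e2 e3
  refine ⟨cov_eq_zero_linearPolicy (fun t => ?_) _, cov_eq_zero_linearPolicy (fun t => ?_) _,
    ?_, ?_⟩
  · simp [linearOutcome]
  · simp [linearOutcome]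
  · simp only [map_sub, map_smul, sub_apply, smul_apply, smul_eq_mul, e4]
    linear_combination (-(c * Q / (c ^ 2 * Q + 1))) * e2
  · simp only [map_sub, map_smul, sub_apply, smul_apply, smul_eq_mul, e5]
    have h1 : C w2 x0 = c * Q := by linarith
    have h2 : C w2 w2 = c ^ 2 * Q + 1 := by
      rw [h1] at e3
      linarith
    rw [h1, h2]
    field_simp
    ring

theorem residual_linearPolicy (hQ : 0 < Q) :
    C (x0 - (0 : ℝ) • w1 - (c * Q / (c ^ 2 * Q + 1)) • w2)
      (x0 - (0 : ℝ) • w1 - (c * Q / (c ^ 2 * Q + 1)) • w2) = Q / (c ^ 2 * Q + 1) := by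
  have hd : 0 < c ^ 2 * Q + 1 := by positivity
  have e1 := cov_V_X0_linearPolicy (Q := Q) (N := N) (a := a) (b := b) (c := c) (p := p) (q := q)
    (k := k)
  rw [← (isRegression_linearPolicy hQ).cov_R_X0]
  simp only [map_sub, map_smul, sub_apply, smul_apply, smul_eq_mul, cov_X0_X0 hQ, cov_W1_X0]
    at e1 ⊢
  have h1 : C w2 x0 = c * Q := by linarith
  rw [h1]
  field_simp
  ring

theorem cov_U1_residual_linearPolicy : C (u1 - a • x0 - b • w1) (u1 - a • x0 - b • w1) = 0 :=
  cov_eq_zero_linearPolicy (fun t => by simp [linearOutcome]) _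

/-- `linearPolicy` meets the constraints with the right choice of `c`. -/
theorem linearPolicy_mem_gaussianPolicies (hQ : 0 < Q) (hN : 0 < N) {P : ℝ}
    (hP : a ^ 2 * Q + b ^ 2 = P) (hc : c ^ 2 = b ^ 2 / (Q * N)) :
    linearPolicy a b c p q k ∈ gaussianPolicies Q N P := by
  refine ⟨?_, ?_, inferInstance⟩
  · have h : ∫ ω : Outcome, ω.U1 ^ 2 ∂(jointLaw Q N (linearPolicy a b c p q k)) = C u1 u1 :=
      integral_sq_linearPolicy u1
    rw [h, (isRegression_linearPolicy hQ).cov_U1_self hQ, cov_U1_residual_linearPolicy,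
      cov_W1_W1_linearPolicy, ← hP]
    ring
  · have hr := isRegression_linearPolicy (N := N) (a := a) (b := b) (c := c) (p := p) (q := q)
      (k := k) hQ
    have hT : C (x0 - (0 : ℝ) • w1 - (c * Q / (c ^ 2 * Q + 1)) • w2)
      (x0 - (0 : ℝ) • w1 - (c * Q / (c ^ 2 * Q + 1)) • w2) = Q / (c ^ 2 * Q + 1) :=
      residual_linearPolicy hQ
    rw [hr.mutualInformation_output hQ hN, hr.mutualInformation_state hQ (by rw [hT]; positivity),
      hT, cov_U1_residual_linearPolicy, cov_W1_W1_linearPolicy, EReal.sub_nonneg (by simp) (by simp)]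
    -- The choice of `c` makes the constraint tight: both variance ratios equal `(b² + N) / N`.
    refine le_of_eq ?_
    congr 4
    rw [hc]
    field_simp
    ring

/-- The cost of `linearPolicy` with the minimum mean square error estimator. -/
theorem estimationCost_linearPolicy (hQ : 0 < Q) (hN : 0 < N) :
    estimationCost Q N (linearPolicy a b c b ((a + 1) * (c * Q / (c ^ 2 * Q + 1))) k)
      = (1 - k) ^ 2 * ((a + 1) ^ 2 * (Q / (c ^ 2 * Q + 1))) + k ^ 2 * N := by
  set π := linearPolicy a b c b ((a + 1) * (c * Q / (c ^ 2 * Q + 1))) k with hπ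
  have h : estimationCost Q N π = covarianceBilinDual (jointLaw Q N π) (x1 - u2) (x1 - u2) :=
    integral_sq_linearPolicy (x1 - u2)
  set R : StrongDual ℝ Outcome := x0 - (0 : ℝ) • w1 - (c * Q / (c ^ 2 * Q + 1)) • w2 with hR
  set Z : StrongDual ℝ Outcome := y1 - x1 with hZ
  -- The decoder coefficients are those of the regression of `X₁` on `(W₁, W₂)`, so `X₁ - U₂`
  -- involves only the orthogonal `R` and `Z`.
  set S : StrongDual ℝ Outcome := ((1 - k) * (a + 1)) • R - k • Z with hS
  have h0 : ∀ L, covarianceBilinDual (jointLaw Q N π) (x1 - u2 - S) L = 0 :=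
    cov_eq_zero_linearPolicy fun t => by
      simp [linearOutcome, hS, hR, hZ]
      ring
  have h1 : ∀ L, covarianceBilinDual (jointLaw Q N π) (x1 - u2) L
      = covarianceBilinDual (jointLaw Q N π) S L := by
    intro L
    have := h0 L
    rw [map_sub (covarianceBilinDual _) _ S, sub_apply] at this
    linarith
  have hZR : covarianceBilinDual (jointLaw Q N π) Z R = 0 := IsRegression.cov_noise_R
  have hRR : covarianceBilinDual (jointLaw Q N π) R R = Q / (c ^ 2 * Q + 1) :=
    residual_linearPolicy hQ
  have hRZ : covarianceBilinDual (jointLaw Q N π) R Z = 0 := by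
    rw [covarianceBilinDual_comm, hZR]
  have hZZ : covarianceBilinDual (jointLaw Q N π) Z Z = N := cov_noise_noise hN
  rw [h, h1, covarianceBilinDual_comm, h1, hS, map_sub (covarianceBilinDual _) (_ • R) (_ • Z),
    sub_apply, map_sub _ (_ • R) (_ • Z), map_sub _ (_ • R) (_ • Z)]
  simp only [map_smul, smul_apply, smul_eq_mul, hZR, hRZ, hRR, hZZ]
  ring

/-- Achievability: the closed form is attained. -/
theorem exists_estimationCost_eq {P : ℝ} (hQ : 0 < Q) (hN : 0 < N) (hP : 0 ≤ P) :
    ∃ π ∈ gaussianPolicies Q N P, estimationCost Q N π = gaussianCostFormula Q N P := by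
  obtain ⟨s, hs, hcost⟩ := exists_slopeCost_eq hQ hN hP
  have hq := Real.sq_sqrt hQ.le
  have hq0 : 0 < √Q := Real.sqrt_pos.2 hQ
  have hden := slopeCost_den_pos hQ hN hs
  -- Inverts `s = √Q (a + 1)`; below, `b` spends all remaining power on `W₁`, and `c` makes the
  -- information constraint tight.
  set a := s / √Q - 1 with ha
  have has : s = √Q * (a + 1) := by
    rw [ha]
    field_simp
    ring
  have haQ : a ^ 2 * Q ≤ P := by
    rw [has] at hs
    refine le_of_eq_of_le ?_ hs
    linear_combination (-a ^ 2) * hq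
  have hb := Real.sq_sqrt (sub_nonneg.2 haQ)
  set b := √(P - a ^ 2 * Q) with hbdef
  have hQN : 0 < Q * N := mul_pos hQ hN
  have hc : (b / √(Q * N)) ^ 2 = b ^ 2 / (Q * N) := by rw [div_pow, Real.sq_sqrt hQN.le]
  set c := b / √(Q * N) with hcdef
  set D := (a + 1) ^ 2 * (Q / (c ^ 2 * Q + 1)) with hD
  have hD0 : 0 ≤ D := by positivity
  refine ⟨linearPolicy a b c b ((a + 1) * (c * Q / (c ^ 2 * Q + 1))) (D / (D + N)),
    linearPolicy_mem_gaussianPolicies hQ hN (by linarith) hc, ?_⟩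
  rw [estimationCost_linearPolicy hQ hN, ← hD, ← hcost, slopeCost]
  have h1 : (1 - D / (D + N)) ^ 2 * D + (D / (D + N)) ^ 2 * N = D * N / (D + N) := by
    field_simp
    ring
  have h2 : D = (a + 1) ^ 2 * Q * N / (b ^ 2 + N) := by
    rw [hD, hc]
    field_simp
  have h3 : s ^ 2 = (a + 1) ^ 2 * Q := by
    rw [has, mul_pow, hq]
    ring
  have h4 : P - Q + N + 2 * √Q * s = (a + 1) ^ 2 * Q + (b ^ 2 + N) := by
    rw [has]
    linear_combination (2 * (a + 1)) * hq - hb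
  rw [h1, h3, h4, h2]
  have h5 : 0 < b ^ 2 + N := by positivity
  field_simp

end Witsenhausen

/-! ### Conclusion -/

namespace Witsenhausen

theorem isLeast_estimationCost {Q N P : ℝ} (hQ : 0 < Q) (hN : 0 < N) (hP : 0 ≤ P) :
    IsLeast (estimationCost Q N '' gaussianPolicies Q N P) (gaussianCostFormula Q N P) := by
  constructor
  · exact exists_estimationCost_eq hQ hN hP
  · rintro _ ⟨π, hπ, rfl⟩
    exact gaussianCostFormula_le_estimationCost hQ hN hπ

theorem optimalGaussianCost_eq {Q N P : ℝ} (hQ : 0 < Q) (hN : 0 < N) (hP : 0 ≤ P) :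
    optimalGaussianCost Q N P = gaussianCostFormula Q N P :=
  (isLeast_estimationCost hQ hN hP).csInf_eq

theorem IsConvexEnvelopeOn.congr {s : Set ℝ} {f g g' : ℝ → ℝ} (h : IsConvexEnvelopeOn s f g)
    (hg : Set.EqOn g' g s) : IsConvexEnvelopeOn s f g' :=
  ⟨h.1.congr hg.symm, fun x hx => (hg hx).trans_le (h.2.1 x hx),
    fun k hk hkf x hx => (h.2.2 k hk hkf x hx).trans_eq (hg hx).symm⟩

end Witsenhausen

/-- In `ℝ` the empty set has no greatest lower bound, so `IsGLB` also carries the non-emptiness of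
the policy set and rules out a default value of `sInf`. -/
theorem mainTheorem1 (Q N : ℝ) (hQ : 0 < Q) (hN : 0 < N) :
    (∀ P : ℝ, 0 ≤ P →
      IsGLB (Witsenhausen.estimationCost Q N '' Witsenhausen.gaussianPolicies Q N P)
        (Witsenhausen.optimalGaussianCost Q N P) ∧
      Witsenhausen.optimalGaussianCost Q N P =
        if 4 * N < Q ∧ P ∈ Set.Icc (Witsenhausen.P₁ Q N) (Witsenhausen.P₂ Q N) then
          N * (Q - N - P) / Q
        else Witsenhausen.bestLinearCost Q N P) ∧
    Witsenhausen.IsConvexEnvelopeOn (Set.Ici 0) (Witsenhausen.bestLinearCost Q N)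
      (Witsenhausen.optimalGaussianCost Q N) := by
  refine ⟨fun P hP => ⟨?_, ?_⟩, ?_⟩
  · rw [Witsenhausen.optimalGaussianCost_eq hQ hN hP]
    exact (Witsenhausen.isLeast_estimationCost hQ hN hP).isGLB
  · rw [Witsenhausen.optimalGaussianCost_eq hQ hN hP, Witsenhausen.gaussianCostFormula]
  · exact (Witsenhausen.isConvexEnvelopeOn_gaussianCostFormula hQ hN).congr
      fun P hP => Witsenhausen.optimalGaussianCost_eq hQ hN hP
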